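/- **Convergence rates of filtered back projection for noisy data.** *Notation.* For $1\le p\le\infty$ and $f:\mathbb R^2\to\mathbb R$ put $\omega_p(f,t)=\sup_{\|h\|\le t}\|f(\cdot-h)-f\|_{L^p(\mathbb R^2)}$. For $0<\theta<1$ let $|f|_{B^{\theta,p}_q}=\big(\int_0^\infty (t^{-\theta}\omega_p(f,t))^q\,\frac{dt}{t}\big)^{1/q}$ if $1\le q<\infty$ and $|f|_{B^{\theta,p}_\infty}=\sup_{t>0}t^{-\theta}\omega_p(f,t)$. For $\alpha=n+\theta$ with an integer $n\ge 0$ let $|f|_{B^{\alpha,p}_q}=\sum_{j_1+j_2=n}\frac{n!}{j_1!j_2!}|f^{(j_1,j_2)}|_{B^{\theta,p}_q}$, with weak derivatives $f^{(j_1,j_2)}$ (and $|f|_{B^{\alpha,p}_q}=\infty$ if one of them does not exist), and $B^{\alpha,p}_q=\{f\in L^p(\mathbb R^2): |f|_{B^{\alpha,p}_q}<\infty\}$. The Radon transform $\mathcal Rf(t,\varphi)$, $(t,\varphi)\in\mathbb R\times[0,\pi)$, is the integral of $f$ over the line $\{x\cos\varphi+y\sin\varphi=t\}$; the back projection is $\mathcal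 Bh(x,y)=\frac1\pi\int_0^\pi h(x\cos\varphi+y\sin\varphi,\varphi)\,d\varphi$; and $\mathcal F^{-1}A(t)=\frac1{2\pi}\int_{\mathbb R}A(S)e^{iSt}\,dS$. For a window $W:\mathbb R\to\mathbb R$ and $L>0$ put $A_L(S)=|S|\,W(S/L)$, $A=A_1$, and $K=\frac12\mathcal B(\mathcal F^{-1}A)$. The reconstruction from data $g$ is $\frac12\mathcal B(\mathcal F^{-1}A_L*g)$, with convolution in the first variable of $g$. *Statement.* Let $1\le p,q\le\infty$, $\alpha=n+\theta$ with an integer $n\ge0$ and $0<\theta<1$, and let $f\in L^1(\mathbb R^2)\cap B^{\alpha,p}_q(\mathbb R^2)$ be real-valued, vanish almost everywhere outside a compact set $\Omega\subset\mathbb R^2$, and satisfy $|f|_{B^{\alpha,p}_q}\neq0$. Let $W\in L^\infty(\mathbb R)$ be even and continuous at $0$ with $W(0)=1$, such that $A\in L^1(\mathbb R)\cap L^2(\mathbb R)$, $\mathcal F^{-1}A\in L^1(\mathbb R)$, $K\in L^1(\mathbb R^2)$, $$\int_{\mathbb R^2}x^{j_1}y^{j_2}K(x,y)\,d(x,y)=0\quad\text{for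 all } 1\le j_1+j_2\le n,\qquad \int_{\mathbb R^2}\|(x,y)\|^\alpha|K(x,y)|\,d(x,y)<\infty .$$ Let $\delta>0$, let $g^\delta\in L^p(\mathbb R\times[0,\pi))$ satisfy $\|\mathcal Rf-g^\delta\|_{L^p(\mathbb R\times[0,\pi))}\le\delta$, and let $f_L^\delta=\frac12\mathcal B(\mathcal F^{-1}A_L*g^\delta)$ with the bandwidth $$L=\delta^{-\frac1{\alpha+1}}\,|f|_{B^{\alpha,p}_q}^{\frac1{\alpha+1}} .$$ Then $f-f_L^\delta\in L^p(\Omega)$ and $$\|f-f_L^\delta\|_{L^p(\Omega)}\le (c_{W,\alpha,q}+c_{W,\Omega,p})\,|f|_{B^{\alpha,p}_q}^{\frac1{\alpha+1}}\,\delta^{\frac{\alpha}{\alpha+1}},$$ where, with $1/\infty=0$, $$c_{W,\Omega,p}=\frac{\operatorname{diam}(\Omega)^{1/p}}{2\pi^{1/p}}\,\|\mathcal F^{-1}A\|_{L^1(\mathbb R)},\qquad c_{W,\alpha,q}=c_{\theta,q}\,\frac{\Gamma(\theta+1)}{\Gamma(\alpha+1)}\int_{\mathbb R^2}\|(x,y)\|^\alpha|K(x,y)|\,d(x,y),$$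 and $c_{\theta,q}=(2e\theta q)^{1/q}$ for $q<\infty$, $c_{\theta,\infty}=1$. In particular, given such data $g^\delta$ for every $\delta>0$, $\|f-f_L^\delta\|_{L^p(\Omega)}=O\big(\delta^{\frac{\alpha}{\alpha+1}}\big)$ as $\delta\searrow0$. -/

import Mathlib

open MeasureTheory Filter Topology Asymptotics
open scoped ENNReal

namespace FBP

noncomputable section

/-- The plane `ℝ²` with its Euclidean norm and Lebesgue measure. -/
abbrev Plane : Type := EuclideanSpace ℝ (Fin 2)

/-! ### Besov seminorms -/

/-- The `Lᵖ`-modulus of continuity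
`ω_p(f, t) = sup_{‖h‖ ≤ t} ‖f(· - h) - f‖_{Lᵖ(ℝ²)}`, with values in `[0, ∞]`. -/
def modulus (p : ℝ≥0∞) (f : Plane → ℝ) (t : ℝ) : ℝ≥0∞ :=
  ⨆ (h : Plane) (_ : ‖h‖ ≤ t), eLpNorm (fun x => f (x - h) - f x) p volume

/-- The Besov seminorm of fractional order `θ ∈ (0, 1)`:
`(∫₀^∞ (t^(-θ) ω_p(f, t))^q dt/t)^(1/q)` for `q < ∞`, and
`sup_{t > 0} t^(-θ) ω_p(f, t)` for `q = ∞`. -/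
def fracSeminorm (θ : ℝ) (p q : ℝ≥0∞) (f : Plane → ℝ) : ℝ≥0∞ :=
  if q = ⊤ then
    ⨆ (t : ℝ) (_ : 0 < t), ENNReal.ofReal (t ^ (-θ)) * modulus p f t
  else
    (∫⁻ t in Set.Ioi (0 : ℝ),
      (ENNReal.ofReal (t ^ (-θ)) * modulus p f t) ^ q.toReal * ENNReal.ofReal (1 / t))
      ^ (1 / q.toReal)

/-- The classical partial derivative in the `i`-th coordinate direction. -/
def partialD (i : Fin 2) (φ : Plane → ℝ) : Plane → ℝ :=
  fun x => fderiv ℝ φ x (EuclideanSpace.single i 1)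

/-- The classical partial derivative of multi-index `j = (j₁, j₂)`. -/
def multiD (j : ℕ × ℕ) (φ : Plane → ℝ) : Plane → ℝ :=
  (partialD 0)^[j.1] ((partialD 1)^[j.2] φ)

/-- `g` is the weak (distributional) derivative of `f` of multi-index `j`. -/
def HasWeakDeriv (j : ℕ × ℕ) (f g : Plane → ℝ) : Prop :=
  LocallyIntegrable g volume ∧
    ∀ φ : Plane → ℝ, ContDiff ℝ (⊤ : ℕ∞) φ → HasCompactSupport φ →
      ∫ x, f x * multiD j φ x = (-1) ^ (j.1 + j.2) * ∫ x, g x * φ x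

open Classical in
/-- A representative of the weak derivative `f^(j)`, which is unique up to null sets
(and `0` if there is none). -/
def weakDeriv (j : ℕ × ℕ) (f : Plane → ℝ) : Plane → ℝ :=
  if h : ∃ g, HasWeakDeriv j f g then h.choose else 0

open Classical in
/-- The seminorm of `B^{n+θ,p}_q(ℝ²)`,
`∑_{j₁ + j₂ = n} n!/(j₁! j₂!) |f^(j₁,j₂)|_{B^{θ,p}_q}`,
being `∞` if one of the weak derivatives of order `n` does not exist.
For `n = 0` this is `|f|_{B^{θ,p}_q}`. -/
def besovSeminorm (n : ℕ) (θ : ℝ) (p q : ℝ≥0∞) (f : Plane → ℝ) : ℝ≥0∞ :=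
  if ∀ j ∈ Finset.HasAntidiagonal.antidiagonal n, ∃ g, HasWeakDeriv j f g then
    ∑ j ∈ Finset.HasAntidiagonal.antidiagonal n, (n.choose j.1 : ℝ≥0∞) * fracSeminorm θ p q (weakDeriv j f)
  else ⊤

/-- Membership in `B^{n+θ,p}_q(ℝ²)`. -/
def MemBesov (n : ℕ) (θ : ℝ) (p q : ℝ≥0∞) (f : Plane → ℝ) : Prop :=
  MemLp f p volume ∧ besovSeminorm n θ p q f < ⊤

/-! ### Radon transform, back projection, filters -/

/-- Radon transform: the integral of `f` over the line
`{(x, y) | x cos φ + y sin φ = t}`, parametrized by arc length; the argument is `(t, φ)`. -/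
def radon (f : Plane → ℝ) (z : ℝ × ℝ) : ℝ :=
  ∫ s : ℝ, f !₂[z.1 * Real.cos z.2 - s * Real.sin z.2, z.1 * Real.sin z.2 + s * Real.cos z.2]

/-- Lebesgue measure on `ℝ × [0, π)`. -/
def sinoMeasure : Measure (ℝ × ℝ) :=
  volume.restrict (Set.univ ×ˢ Set.Ico 0 Real.pi)

/-- Back projection `(1/π) ∫₀^π h(x cos φ + y sin φ, φ) dφ`. -/
def backProj (h : ℝ × ℝ → ℂ) (x : Plane) : ℂ :=
  (1 / Real.pi : ℝ) • ∫ φ in (0 : ℝ)..Real.pi, h (x 0 * Real.cos φ + x 1 * Real.sin φ, φ)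

/-- The low-pass filter `A_L(S) = |S| W(S/L)`. -/
def lowPass (W : ℝ → ℝ) (L : ℝ) (S : ℝ) : ℝ := |S| * W (S / L)

/-- The inverse Fourier transform `(1/2π) ∫ A(S) e^{iSt} dS`. -/
def invFourier (A : ℝ → ℝ) (t : ℝ) : ℂ :=
  (1 / (2 * Real.pi) : ℝ) • ∫ S : ℝ, (A S : ℂ) * Complex.exp (Complex.I * S * t)

/-- The convolution kernel `K_L = (1/2) B(F⁻¹ A_L)` on the plane. -/
def convKernel (W : ℝ → ℝ) (L : ℝ) (x : Plane) : ℂ :=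
  (1 / 2 : ℝ) • backProj (fun z => invFourier (lowPass W L) z.1) x

/-- The filtered data `F⁻¹ A_L * g`, a convolution in the first variable. -/
def filtered (W : ℝ → ℝ) (L : ℝ) (g : ℝ × ℝ → ℝ) (z : ℝ × ℝ) : ℂ :=
  ∫ s : ℝ, invFourier (lowPass W L) s * (g (z.1 - s, z.2) : ℂ)

/-- The filtered back projection reconstruction `(1/2) B(F⁻¹ A_L * g)` from the data `g`. -/
def reconstruction (W : ℝ → ℝ) (L : ℝ) (g : ℝ × ℝ → ℝ) (x : Plane) : ℂ :=
  (1 / 2 : ℝ) • backProj (filtered W L g) x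

/-! ### Constants and the choice of the bandwidth -/

/-- `c_{θ,q} = (2 e θ q)^(1/q)` for `q < ∞`, and `1` for `q = ∞`. -/
def cFrac (θ : ℝ) (q : ℝ≥0∞) : ℝ :=
  if q = ⊤ then 1 else (2 * Real.exp 1 * θ * q.toReal) ^ (1 / q.toReal)

/-- `c_{W,α,q}` for `α = n + θ`. -/
def cApprox (W : ℝ → ℝ) (n : ℕ) (θ : ℝ) (q : ℝ≥0∞) : ℝ :=
  cFrac θ q * (Real.Gamma (θ + 1) / Real.Gamma (n + θ + 1)) *
    ∫ x : Plane, ‖x‖ ^ (n + θ) * ‖convKernel W 1 x‖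

/-- `c_{W,Ω,p} = (1/2) π^(-1/p) diam(Ω)^(1/p) ‖F⁻¹ A‖_{L¹(ℝ)}`. For `p = ∞`, the exponent
`1 / p.toReal` is `0`, in accordance with `1/∞ = 0`. -/
def cData (W : ℝ → ℝ) (Ω : Set Plane) (p : ℝ≥0∞) : ℝ :=
  1 / (2 * Real.pi ^ (1 / p.toReal)) * Metric.diam Ω ^ (1 / p.toReal) *
    ∫ t : ℝ, ‖invFourier (lowPass W 1) t‖

/-- The bandwidth `L = δ^(-1/(α+1)) N^(1/(α+1))`, where `N` is the Besov seminorm. -/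
def bandwidth (α N δ : ℝ) : ℝ := δ ^ (-(1 / (α + 1))) * N ^ (1 / (α + 1))

end

end FBP

/-! Write `f_L` for the reconstruction from exact data and split the error as `(f - f_L) + (f_L -
f_L^δ)`.

Approximation error. Filtered back projection of `Rf` is a convolution: `f_L = K_L * f` with `K_L(x)
= L² K(Lx)` (`reconstruction_radon`, `convKernel_scale`). In polar coordinates the factor `|S|` of
the filter is the Jacobian, so `K` is, up to normalization, the Fourier transform of the radial
function `W(‖ξ‖)`, and Fourier inversion at the origin gives `∫ K = W(0) = 1`
(`integral_convKernel`). Since the moments of orders `1, …, n` vanish, `K_L` sees only the remainder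
of the order-`n` Taylor expansion of `y ↦ f(x - y)`. That remainder is an average of increments of
the derivatives of order `n`. Their `Lᵖ` norms are controlled by the Besov seminorm (`modulus_le`),
and integrating over the Taylor parameter yields `Γ(θ+1)/Γ(α+1)` (`lintegral_beta`,
`eLpNorm_taylorRem_le`). Minkowski's inequality bounds the error by the `α`-th absolute moment of
`K_L`, which is `L^(-α)` times that of `K`. The expansion needs smoothness, so it is applied to
mollifications of `f`; these satisfy the same increment bounds, and Fatou's lemma passes to the
limit (`eLpNorm_sub_convolution_le`).

Data error. Young's inequality in the first variable costs `‖F⁻¹A_L‖₁ = L ‖F⁻¹A‖₁`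
(`eLpNorm_absFiltered_le`). Back projection is bounded from `Lᵖ(ℝ × [0, π))` to `Lᵖ(Ω)`, because
every line meets `Ω` in length at most `diam Ω` (`eLpNorm_backProj_le`).

The total is at most `c L^(-α) |f| + c' L δ`, and the chosen bandwidth makes `L^(-α) |f|` and `L δ`
equal. -/

open MeasureTheory Filter Topology Asymptotics
open scoped ENNReal

namespace FBP

/-! ### Minkowski's integral inequality -/

section Minkowski

variable {X Y : Type*} [MeasurableSpace X] [MeasurableSpace Y] {μ : Measure X} {ν : Measure Y}

theorem rpow_one_sub_mul_rpow_le {p : ℝ} (hp : 1 < p) {b : ℝ≥0∞} (hb : b ≠ ∞) :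
    b ^ (1 - p) * b ^ p ≤ b := by
  rcases eq_or_ne b 0 with rfl | h0
  · rw [ENNReal.zero_rpow_of_pos (y := p) (by linarith)]; simp
  · rw [← ENNReal.rpow_add _ _ h0 hb]; simp

/-- For `1 < p < ∞`, Hölder applied to `F = (F b^(-1/q)) · b^(1/q)` gives `(∫ F)^r ≤ (∫ F^r b^(1-r))
(∫ b)^(r-1)` pointwise in `x`; integrating in `x` and using Tonelli leaves `(∫ b)^r`. No duality is
needed. For `p = ∞` the two almost-everywhere quantifiers are exchanged. -/
theorem eLpNorm_lintegral_le_of_measurable [SFinite μ] [SFinite ν] {p : ℝ≥0∞} (hp : 1 ≤ p)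
    {F : X → Y → ℝ≥0∞} (hF : Measurable (Function.uncurry F)) {b : Y → ℝ≥0∞} (hb : Measurable b)
    (h : ∀ᵐ y ∂ν, eLpNorm (fun x => F x y) p μ ≤ b y) :
    eLpNorm (fun x => ∫⁻ y, F x y ∂ν) p μ ≤ ∫⁻ y, b y ∂ν := by
  rcases eq_or_ne p ∞ with rfl | hpt
  · have h1 : ∀ᵐ y ∂ν, ∀ᵐ x ∂μ, F x y ≤ b y := by
      filter_upwards [h] with y hy
      rw [eLpNorm_exponent_top] at hy
      filter_upwards [ae_le_eLpNormEssSup (f := fun x => F x y) (μ := μ)] with x hx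
      exact le_trans (by simpa using hx) hy
    have h2 : ∀ᵐ x ∂μ, ∀ᵐ y ∂ν, F x y ≤ b y := by
      refine (Measure.ae_ae_comm ?_).2 h1
      exact measurableSet_le hF (hb.comp measurable_snd)
    rw [eLpNorm_exponent_top]
    refine eLpNormEssSup_le_of_ae_enorm_bound ?_
    filter_upwards [h2] with x hx
    simpa using lintegral_mono_ae hx
  by_cases hB : ∫⁻ y, b y ∂ν = ∞
  · rw [hB]; exact le_top
  have hbt : ∀ᵐ y ∂ν, b y ≠ ∞ := by
    filter_upwards [ae_lt_top hb hB] with y hy using hy.ne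
  have hp0 : p ≠ 0 := (zero_lt_one.trans_le hp).ne'
  have hr1 : 1 ≤ p.toReal := by
    simpa using (ENNReal.toReal_le_toReal (by simp) hpt).2 hp
  obtain ⟨r, hr⟩ : ∃ r, r = p.toReal := ⟨_, rfl⟩
  rw [← hr] at hr1
  have hr0 : 0 < r := by linarith
  have hle : ∀ᵐ y ∂ν, ∫⁻ x, F x y ^ r ∂μ ≤ b y ^ r := by
    filter_upwards [h] with y hy
    rw [eLpNorm_eq_lintegral_rpow_enorm_toReal hp0 hpt, ← hr] at hy
    have := ENNReal.rpow_le_rpow hy hr0.le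
    rw [← ENNReal.rpow_mul, one_div, inv_mul_cancel₀ hr0.ne', ENNReal.rpow_one] at this
    simpa using this
  rw [eLpNorm_eq_lintegral_rpow_enorm_toReal hp0 hpt, ← hr]
  simp only [enorm_eq_self]
  rw [one_div, ENNReal.rpow_inv_le_iff hr0]
  -- The conjugate exponent degenerates at `r = 1`, where Tonelli alone suffices.
  rcases hr1.eq_or_lt with h1 | h1
  · subst h1
    simp only [ENNReal.rpow_one] at hle ⊢
    rw [lintegral_lintegral_swap hF.aemeasurable]
    exact lintegral_mono_ae hle
  set q := Real.conjExponent r with hq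
  have hpq : r.HolderConjugate q := Real.HolderConjugate.conjExponent h1
  have hq0 : 0 < q := hpq.symm.pos
  -- Where `b y = 0` the weight `b y ^ (-(1 / q))` is `∞` and cannot be cancelled, so the Hölder
  -- factorization needs `F` to vanish there.
  have hzero : ∀ᵐ x ∂μ, ∀ᵐ y ∂ν, b y = 0 → F x y = 0 := by
    refine (Measure.ae_ae_comm (p := fun x y => b y = 0 → F x y = 0) ?_).2 ?_
    · have : {z : X × Y | b z.2 = 0 → F z.1 z.2 = 0} =
          {z | b z.2 = 0}ᶜ ∪ {z | Function.uncurry F z = 0} := by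
        ext z; simp [imp_iff_not_or, Function.uncurry]
      rw [this]
      exact ((hb.comp measurable_snd) (measurableSet_singleton 0)).compl.union
        (hF (measurableSet_singleton 0))
    · filter_upwards [hle] with y hy
      by_cases hy0 : b y = 0
      · have hFy : Measurable fun x => F x y ^ r :=
          (hF.comp (measurable_id.prodMk measurable_const)).pow_const r
        rw [hy0, ENNReal.zero_rpow_of_pos hr0, nonpos_iff_eq_zero, lintegral_eq_zero_iff hFy] at hy
        filter_upwards [hy] with x hx _
        simpa [hr0, not_lt.2 hr0.le] using hx
      · simp [hy0]
  have hpt' : ∀ᵐ x ∂μ, (∫⁻ y, F x y ∂ν) ^ r ≤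
      (∫⁻ y, F x y ^ r * b y ^ (1 - r) ∂ν) * (∫⁻ y, b y ∂ν) ^ (r - 1) := by
    filter_upwards [hzero] with x hx
    have hFx : Measurable (fun y => F x y) := hF.comp (measurable_const.prodMk measurable_id)
    have e1 : ∫⁻ y, F x y ∂ν ≤
        ∫⁻ y, ((fun y => F x y * b y ^ (-(1 / q))) * fun y => b y ^ (1 / q)) y ∂ν := by
      refine lintegral_mono_ae ?_
      filter_upwards [hx, hbt] with y h0 ht
      by_cases hy : b y = 0
      · rw [h0 hy]; simp
      · simp only [Pi.mul_apply]
        rw [mul_assoc, ← ENNReal.rpow_add _ _ hy ht]; simp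
    have e2 := ENNReal.lintegral_mul_le_Lp_mul_Lq ν hpq
      (hFx.mul (hb.pow_const (-(1 / q)))).aemeasurable (hb.pow_const (1 / q)).aemeasurable
    have e3 := ENNReal.rpow_le_rpow (e1.trans e2) hr0.le
    refine e3.trans (le_of_eq ?_)
    rw [ENNReal.mul_rpow_of_nonneg _ _ hr0.le, ← ENNReal.rpow_mul, ← ENNReal.rpow_mul]
    have hrq : 1 / q * r = r - 1 := by
      rw [hq, Real.conjExponent]; field_simp
    congr 1
    · rw [one_div_mul_cancel hr0.ne', ENNReal.rpow_one]
      refine lintegral_congr fun y => ?_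
      rw [Pi.mul_apply, ENNReal.mul_rpow_of_nonneg _ _ hr0.le, ← ENNReal.rpow_mul]
      congr 2
      linarith
    · rw [hrq]
      congr 1
      refine lintegral_congr fun y => ?_
      rw [← ENNReal.rpow_mul, one_div, inv_mul_cancel₀ hq0.ne', ENNReal.rpow_one]
  calc ∫⁻ x, (∫⁻ y, F x y ∂ν) ^ r ∂μ
      ≤ ∫⁻ x, (∫⁻ y, F x y ^ r * b y ^ (1 - r) ∂ν) * (∫⁻ y, b y ∂ν) ^ (r - 1) ∂μ :=
        lintegral_mono_ae hpt'
    _ = (∫⁻ x, ∫⁻ y, F x y ^ r * b y ^ (1 - r) ∂ν ∂μ) * (∫⁻ y, b y ∂ν) ^ (r - 1) :=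
        lintegral_mul_const' _ _ (ENNReal.rpow_ne_top_of_nonneg (by linarith) hB)
    _ = (∫⁻ y, (∫⁻ x, F x y ^ r ∂μ) * b y ^ (1 - r) ∂ν) * (∫⁻ y, b y ∂ν) ^ (r - 1) := by
        rw [lintegral_lintegral_swap]
        · congr 1
          refine lintegral_congr fun y => ?_
          rw [lintegral_mul_const]
          exact (hF.comp (measurable_id.prodMk measurable_const)).pow_const r
        · exact ((hF.pow_const r).mul ((hb.comp measurable_snd).pow_const _)).aemeasurable
    _ ≤ (∫⁻ y, b y ∂ν) * (∫⁻ y, b y ∂ν) ^ (r - 1) := by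
        gcongr 1
        refine lintegral_mono_ae ?_
        filter_upwards [hle, hbt] with y hy ht
        calc _ ≤ b y ^ r * b y ^ (1 - r) := by gcongr
          _ ≤ b y := by rw [mul_comm]; exact rpow_one_sub_mul_rpow_le h1 ht
    _ = (∫⁻ y, b y ∂ν) ^ r := by
        nth_rewrite 1 [← ENNReal.rpow_one (∫⁻ y, b y ∂ν)]
        rw [← ENNReal.rpow_add_of_nonneg _ _ (by norm_num) (by linarith)]
        congr 1; ring

/-- Minkowski's integral inequality. -/
theorem eLpNorm_lintegral_le [SFinite μ] [SFinite ν] {p : ℝ≥0∞} (hp : 1 ≤ p)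
    {F : X → Y → ℝ≥0∞} (hF : AEMeasurable (Function.uncurry F) (μ.prod ν))
    {b : Y → ℝ≥0∞} (hb : AEMeasurable b ν)
    (h : ∀ᵐ y ∂ν, eLpNorm (fun x => F x y) p μ ≤ b y) :
    eLpNorm (fun x => ∫⁻ y, F x y ∂ν) p μ ≤ ∫⁻ y, b y ∂ν := by
  have hFe : ∀ᵐ x ∂μ, ∀ᵐ y ∂ν, F x y = hF.mk _ (x, y) := Measure.ae_ae_of_ae_prod hF.ae_eq_mk
  have hFe' : ∀ᵐ y ∂ν, ∀ᵐ x ∂μ, F x y = hF.mk _ (x, y) := by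
    exact Measure.ae_ae_of_ae_prod (p := fun z : Y × X => F z.2 z.1 = hF.mk _ (z.2, z.1))
      (Measure.measurePreserving_swap.quasiMeasurePreserving.ae hF.ae_eq_mk)
  rw [lintegral_congr_ae hb.ae_eq_mk]
  refine (eLpNorm_congr_ae ?_).trans_le (eLpNorm_lintegral_le_of_measurable hp
    (F := fun x y => hF.mk _ (x, y)) hF.measurable_mk hb.measurable_mk ?_)
  · filter_upwards [hFe] with x hx using lintegral_congr_ae hx
  · filter_upwards [hFe', hb.ae_eq_mk, h] with y h1 h2 h3
    rw [← h2]
    exact (eLpNorm_congr_ae h1).symm.trans_le h3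

/-- Minkowski's integral inequality for Bochner integrals. -/
theorem eLpNorm_integral_le [SFinite μ] [SFinite ν] {E : Type*} [NormedAddCommGroup E]
    [NormedSpace ℝ E] {p : ℝ≥0∞} (hp : 1 ≤ p)
    {F : X → Y → E} (hF : AEStronglyMeasurable (Function.uncurry F) (μ.prod ν))
    {b : Y → ℝ≥0∞} (hb : AEMeasurable b ν)
    (h : ∀ᵐ y ∂ν, eLpNorm (fun x => F x y) p μ ≤ b y) :
    eLpNorm (fun x => ∫ y, F x y ∂ν) p μ ≤ ∫⁻ y, b y ∂ν := by
  refine le_trans (eLpNorm_mono_enorm (g := fun x => ∫⁻ y, ‖F x y‖ₑ ∂ν) fun x => ?_)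
    (eLpNorm_lintegral_le hp (F := fun x y => ‖F x y‖ₑ) hF.enorm hb ?_)
  · simpa using enorm_integral_le_lintegral_enorm _
  · simpa using h

end Minkowski

/-! ### Besov seminorm and modulus of continuity -/

section Modulus

theorem modulus_mono (p : ℝ≥0∞) (f : Plane → ℝ) {s t : ℝ} (hst : s ≤ t) :
    modulus p f s ≤ modulus p f t :=
  iSup_mono fun _ => iSup_le fun hh => le_iSup_of_le (hh.trans hst) le_rfl

theorem eLpNorm_translate_sub_le_modulus (p : ℝ≥0∞) (f : Plane → ℝ) (h : Plane) :
    eLpNorm (fun x => f (x - h) - f x) p volume ≤ modulus p f ‖h‖ :=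
  le_iSup₂_of_le (f := fun (h' : Plane) (_ : ‖h'‖ ≤ ‖h‖) =>
    eLpNorm (fun x => f (x - h') - f x) p volume) h le_rfl le_rfl

theorem cFrac_nonneg {θ : ℝ} (hθ : 0 < θ) (q : ℝ≥0∞) : 0 ≤ cFrac θ q := by
  unfold cFrac
  split_ifs <;> positivity

theorem lintegral_Ioi_rpow {a t : ℝ} (ha : a < -1) (ht : 0 < t) :
    ∫⁻ s in Set.Ioi t, ENNReal.ofReal (s ^ a) = ENNReal.ofReal (-t ^ (a + 1) / (a + 1)) := by
  rw [← integral_Ioi_rpow_of_lt ha ht,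
    ofReal_integral_eq_lintegral_ofReal (integrableOn_Ioi_rpow_of_lt ha ht)]
  filter_upwards [ae_restrict_mem measurableSet_Ioi] with s hs
  exact Real.rpow_nonneg (ht.trans hs).le _

/-- The modulus is nondecreasing in `t`, so for `q < ∞` the part of the seminorm integral over `(t,
∞)` is already at least `ω(t)^q ∫_t^∞ s^(-θq-1) ds = ω(t)^q t^(-θq)/(θq)`. -/
theorem modulus_le {θ : ℝ} (hθ : 0 < θ) {p q : ℝ≥0∞} (hq : 1 ≤ q) (f : Plane → ℝ) {t : ℝ}
    (ht : 0 < t) :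
    modulus p f t ≤ ENNReal.ofReal (cFrac θ q * t ^ θ) * fracSeminorm θ p q f := by
  have hcancel : ∀ a : ℝ, ENNReal.ofReal (t ^ a) * ENNReal.ofReal (t ^ (-a)) = 1 := fun a => by
    rw [← ENNReal.ofReal_mul (by positivity), ← Real.rpow_add ht]; simp
  unfold fracSeminorm cFrac
  split_ifs with hqt
  · have : ENNReal.ofReal (t ^ (-θ)) * modulus p f t ≤
        ⨆ (t : ℝ) (_ : 0 < t), ENNReal.ofReal (t ^ (-θ)) * modulus p f t :=
      le_iSup₂_of_le (f := fun (t : ℝ) (_ : 0 < t) => ENNReal.ofReal (t ^ (-θ)) * modulus p f t)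
        t ht le_rfl
    calc modulus p f t = ENNReal.ofReal (t ^ θ) * (ENNReal.ofReal (t ^ (-θ)) * modulus p f t) := by
          rw [← mul_assoc, hcancel, one_mul]
      _ ≤ _ := by rw [one_mul]; gcongr
  obtain ⟨r, hr⟩ : ∃ r, r = q.toReal := ⟨_, rfl⟩
  have hr1 : 1 ≤ r := by
    rw [hr]; simpa using (ENNReal.toReal_le_toReal (by simp) hqt).2 hq
  have hr0 : 0 < r := by linarith
  rw [← hr]
  set M := modulus p f t
  set I := ∫⁻ s in Set.Ioi (0 : ℝ),
      (ENNReal.ofReal (s ^ (-θ)) * modulus p f s) ^ r * ENNReal.ofReal (1 / s)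
  have hI : M ^ r * ENNReal.ofReal (t ^ (-(θ * r)) / (θ * r)) ≤ I := by
    have e1 : ENNReal.ofReal (t ^ (-(θ * r)) / (θ * r)) =
        ∫⁻ s in Set.Ioi t, ENNReal.ofReal (s ^ (-(θ * r) - 1)) := by
      rw [lintegral_Ioi_rpow (by nlinarith) ht]
      congr 1
      rw [sub_add_cancel, neg_div_neg_eq]
    calc M ^ r * ENNReal.ofReal (t ^ (-(θ * r)) / (θ * r))
        = ∫⁻ s in Set.Ioi t, M ^ r * ENNReal.ofReal (s ^ (-(θ * r) - 1)) := by
          rw [e1, lintegral_const_mul]; fun_prop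
      _ ≤ ∫⁻ s in Set.Ioi t,
          (ENNReal.ofReal (s ^ (-θ)) * modulus p f s) ^ r * ENNReal.ofReal (1 / s) := by
          refine setLIntegral_mono' measurableSet_Ioi fun s hs => ?_
          have hs0 : 0 < s := ht.trans hs
          have : ENNReal.ofReal (s ^ (-(θ * r) - 1)) =
              ENNReal.ofReal (s ^ (-θ)) ^ r * ENNReal.ofReal (1 / s) := by
            rw [ENNReal.ofReal_rpow_of_nonneg (by positivity) hr0.le,
              ← ENNReal.ofReal_mul (by positivity), ← Real.rpow_mul hs0.le, Real.rpow_sub hs0]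
            congr 1
            rw [Real.rpow_one, neg_mul]; ring
          rw [this, ENNReal.mul_rpow_of_nonneg _ _ hr0.le, ← mul_assoc, mul_comm (M ^ r)]
          gcongr
          exact modulus_mono p f (le_of_lt hs)
      _ ≤ I := lintegral_mono_set (Set.Ioi_subset_Ioi ht.le)
  have hM : M ^ r ≤ ENNReal.ofReal (2 * Real.exp 1 * θ * r * t ^ (θ * r)) * I := by
    calc M ^ r = ENNReal.ofReal (θ * r * t ^ (θ * r)) *
          (M ^ r * ENNReal.ofReal (t ^ (-(θ * r)) / (θ * r))) := by
          rw [mul_left_comm, ← ENNReal.ofReal_mul (by positivity)]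
          have : θ * r * t ^ (θ * r) * (t ^ (-(θ * r)) / (θ * r)) = 1 := by
            rw [Real.rpow_neg ht.le]; field_simp
          rw [this]; simp
      _ ≤ ENNReal.ofReal (θ * r * t ^ (θ * r)) * I := by gcongr
      _ ≤ _ := by
          gcongr
          -- The argument gives the constant `θ r`; the factor `2e ≥ 1` in `cFrac` only weakens it.
          have := Real.add_one_le_exp (1 : ℝ)
          have : 0 < θ * r := by positivity
          nlinarith
  have h3 := ENNReal.rpow_le_rpow hM (z := 1 / r) (by positivity)
  rw [← ENNReal.rpow_mul, mul_one_div_cancel hr0.ne', ENNReal.rpow_one,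
    ENNReal.mul_rpow_of_nonneg _ _ (by positivity),
    ENNReal.ofReal_rpow_of_nonneg (by positivity) (by positivity),
    Real.mul_rpow (by positivity) (by positivity), ← Real.rpow_mul ht.le, mul_assoc θ r,
    mul_one_div_cancel hr0.ne', mul_one] at h3
  exact h3

theorem eLpNorm_translate_sub_le {θ : ℝ} (hθ : 0 < θ) {p q : ℝ≥0∞} (hq : 1 ≤ q) (f : Plane → ℝ)
    (h : Plane) :
    eLpNorm (fun x => f (x - h) - f x) p volume ≤
      ENNReal.ofReal (cFrac θ q * ‖h‖ ^ θ) * fracSeminorm θ p q f := by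
  rcases eq_or_ne h 0 with rfl | hh
  · simp
  · exact (eLpNorm_translate_sub_le_modulus p f h).trans (modulus_le hθ hq f (norm_pos_iff.2 hh))

end Modulus

/-! ### Calculus of iterated partial derivatives -/

section PartialDerivatives

open scoped ContDiff

theorem contDiff_partialD {u : Plane → ℝ} (hu : ContDiff ℝ ∞ u) (i : Fin 2) :
    ContDiff ℝ ∞ (partialD i u) :=
  (hu.fderiv_right (m := ∞) (by simp)).clm_apply contDiff_const

theorem contDiff_partialD_iterate {u : Plane → ℝ} (hu : ContDiff ℝ ∞ u) (i : Fin 2) (k : ℕ) :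
    ContDiff ℝ ∞ ((partialD i)^[k] u) := by
  induction k with
  | zero => exact hu
  | succ k ih => rw [Function.iterate_succ_apply']; exact contDiff_partialD ih i

theorem contDiff_multiD {u : Plane → ℝ} (hu : ContDiff ℝ ∞ u) (j : ℕ × ℕ) :
    ContDiff ℝ ∞ (multiD j u) :=
  contDiff_partialD_iterate (contDiff_partialD_iterate hu 1 j.2) 0 j.1

theorem partialD_comm {u : Plane → ℝ} (hu : ContDiff ℝ ∞ u) (i k : Fin 2) :
    partialD i (partialD k u) = partialD k (partialD i u) := by
  have hd : ∀ x, DifferentiableAt ℝ (fderiv ℝ u) x := fun x =>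
    ((hu.fderiv_right (m := ∞) (by simp)).differentiable (by simp)) x
  have key : ∀ (a b : Fin 2) x, partialD a (partialD b u) x =
      fderiv ℝ (fderiv ℝ u) x (EuclideanSpace.single a 1) (EuclideanSpace.single b 1) := by
    intro a b x
    unfold partialD
    rw [fderiv_clm_apply (hd x) (differentiableAt_const _)]
    simp
  funext x
  rw [key, key]
  have hs : IsSymmSndFDerivAt ℝ u x := (hu.contDiffAt).isSymmSndFDerivAt
    (by rw [minSmoothness_of_isRCLikeNormedField]; exact WithTop.coe_le_coe.2 (le_top : (2 : ℕ∞) ≤ ⊤))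
  exact hs _ _

theorem partialD_partialD_iterate {u : Plane → ℝ} (hu : ContDiff ℝ ∞ u) (i k : Fin 2) (m : ℕ) :
    partialD i ((partialD k)^[m] u) = (partialD k)^[m] (partialD i u) := by
  induction m with
  | zero => rfl
  | succ m ih =>
    rw [Function.iterate_succ_apply', Function.iterate_succ_apply', ← ih,
      partialD_comm (contDiff_partialD_iterate hu k m)]

theorem partialD_zero_multiD (u : Plane → ℝ) (a b : ℕ) :
    partialD 0 (multiD (a, b) u) = multiD (a + 1, b) u :=
  (Function.iterate_succ_apply' (partialD 0) a _).symm

/-- `multiD` applies the derivatives in direction `0` last, so the new derivative in direction `1`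
has to be commuted past them; this uses the symmetry of second derivatives. -/
theorem partialD_one_multiD {u : Plane → ℝ} (hu : ContDiff ℝ ∞ u) (a b : ℕ) :
    partialD 1 (multiD (a, b) u) = multiD (a, b + 1) u := by
  unfold multiD
  rw [partialD_partialD_iterate (contDiff_partialD_iterate hu 1 b)]
  simp only [Function.iterate_succ_apply']

theorem hasCompactSupport_partialD {u : Plane → ℝ} (hu : HasCompactSupport u) (i : Fin 2) :
    HasCompactSupport (partialD i u) :=
  (hu.fderiv (𝕜 := ℝ)).comp_left (g := fun A : Plane →L[ℝ] ℝ => A (EuclideanSpace.single i 1)) rfl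

theorem hasCompactSupport_partialD_iterate {u : Plane → ℝ} (hu : HasCompactSupport u) (i : Fin 2)
    (k : ℕ) : HasCompactSupport ((partialD i)^[k] u) := by
  induction k with
  | zero => exact hu
  | succ k ih => rw [Function.iterate_succ_apply']; exact hasCompactSupport_partialD ih i

theorem partialD_reflect {u : Plane → ℝ} (hu : ContDiff ℝ ∞ u) (x : Plane) (i : Fin 2) :
    partialD i (fun y => u (x - y)) = fun y => -partialD i u (x - y) := by
  funext y
  simp only [partialD]
  have h := ((hu.differentiable (by simp) (x - y)).hasFDerivAt).comp y
    ((hasFDerivAt_id y).const_sub x)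
  rw [HasFDerivAt.fderiv (f := fun y => u (x - y)) h]
  simp

theorem partialD_const_mul {u : Plane → ℝ} (hu : ContDiff ℝ ∞ u) (c : ℝ) (i : Fin 2) :
    partialD i (fun y => c * u y) = fun y => c * partialD i u y := by
  funext y
  simp only [partialD]
  rw [fderiv_const_mul (hu.differentiable (by simp) y)]
  simp

theorem partialD_iterate_reflect {u : Plane → ℝ} (hu : ContDiff ℝ ∞ u) (x : Plane) (i : Fin 2)
    (c : ℝ) (k : ℕ) :
    (partialD i)^[k] (fun y => c * u (x - y)) =
      fun y => (-1) ^ k * c * (partialD i)^[k] u (x - y) := by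
  induction k with
  | zero => simp
  | succ k ih =>
    have hk := contDiff_partialD_iterate hu i k
    rw [Function.iterate_succ_apply', ih,
      partialD_const_mul (u := fun y => (partialD i)^[k] u (x - y))
        (hk.comp (contDiff_const.sub contDiff_id)), partialD_reflect hk,
      Function.iterate_succ_apply']
    funext y; ring

theorem multiD_reflect {u : Plane → ℝ} (hu : ContDiff ℝ ∞ u) (x : Plane) (j : ℕ × ℕ) :
    multiD j (fun y => u (x - y)) = fun y => (-1) ^ (j.1 + j.2) * multiD j u (x - y) := by
  unfold multiD
  have h1 := partialD_iterate_reflect hu x 1 1 j.2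
  simp only [one_mul, mul_one] at h1
  rw [h1, partialD_iterate_reflect (contDiff_partialD_iterate hu 1 j.2), pow_add]

end PartialDerivatives

/-! ### Mollification and weak derivatives -/

section Mollification

open scoped ContDiff Convolution

theorem partialD_convolution {ρ f : Plane → ℝ} (hρ : ContDiff ℝ ∞ ρ) (hc : HasCompactSupport ρ)
    (hf : LocallyIntegrable f volume) (i : Fin 2) :
    partialD i (ρ ⋆[ContinuousLinearMap.lsmul ℝ ℝ] f) =
      partialD i ρ ⋆[ContinuousLinearMap.lsmul ℝ ℝ] f := by
  funext x
  have h := hc.hasFDerivAt_convolution_left (ContinuousLinearMap.lsmul ℝ ℝ) (hρ.of_le (by simp))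
    hf x
  have hex := (hc.fderiv (𝕜 := ℝ)).convolutionExists_left
    ((ContinuousLinearMap.lsmul ℝ ℝ : ℝ →L[ℝ] ℝ →L[ℝ] ℝ).precompL Plane)
    (hρ.continuous_fderiv (by simp)) hf x
  rw [partialD, h.fderiv, convolution_def, ContinuousLinearMap.integral_apply hex]
  simp [convolution_def, partialD]

theorem partialD_iterate_convolution {ρ f : Plane → ℝ} (hρ : ContDiff ℝ ∞ ρ)
    (hc : HasCompactSupport ρ) (hf : LocallyIntegrable f volume) (i : Fin 2) (k : ℕ) :
    (partialD i)^[k] (ρ ⋆[ContinuousLinearMap.lsmul ℝ ℝ] f) =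
      (partialD i)^[k] ρ ⋆[ContinuousLinearMap.lsmul ℝ ℝ] f := by
  induction k with
  | zero => rfl
  | succ k ih =>
    rw [Function.iterate_succ_apply', Function.iterate_succ_apply', ih,
      partialD_convolution (contDiff_partialD_iterate hρ i k)
        (hasCompactSupport_partialD_iterate hc i k) hf]

/-- All derivatives fall on `ρ`. Testing the weak derivative against `y ↦ ρ (x - y)` moves them to
`f`; the sign from reflection cancels the sign from integration by parts. -/
theorem multiD_convolution {ρ f g : Plane → ℝ} (hρ : ContDiff ℝ ∞ ρ)
    (hc : HasCompactSupport ρ) (hf : LocallyIntegrable f volume) {j : ℕ × ℕ}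
    (hg : HasWeakDeriv j f g) :
    multiD j (ρ ⋆[ContinuousLinearMap.lsmul ℝ ℝ] f) = ρ ⋆[ContinuousLinearMap.lsmul ℝ ℝ] g := by
  have h1 : multiD j (ρ ⋆[ContinuousLinearMap.lsmul ℝ ℝ] f) =
      multiD j ρ ⋆[ContinuousLinearMap.lsmul ℝ ℝ] f := by
    unfold multiD
    rw [partialD_iterate_convolution hρ hc hf, partialD_iterate_convolution
      (contDiff_partialD_iterate hρ 1 j.2) (hasCompactSupport_partialD_iterate hc 1 j.2) hf]
  rw [h1]
  funext x
  rw [convolution_lsmul_swap, convolution_lsmul_swap]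
  have h2 := hg.2 (fun y => ρ (x - y)) (hρ.comp (contDiff_const.sub contDiff_id))
    (hc.comp_homeomorph (Homeomorph.subLeft x))
  rw [multiD_reflect hρ] at h2
  have hs : ((-1 : ℝ) ^ (j.1 + j.2)) * (-1) ^ (j.1 + j.2) = 1 := by
    rw [← mul_pow]; simp
  have h3 : ∫ y, f y * ((-1) ^ (j.1 + j.2) * multiD j ρ (x - y)) =
      (-1) ^ (j.1 + j.2) * ∫ y, multiD j ρ (x - y) • f y := by
    rw [← integral_const_mul]
    congr 1; funext y; simp only [smul_eq_mul]; ring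
  rw [h3] at h2
  have h4 := congrArg (fun z => (-1 : ℝ) ^ (j.1 + j.2) * z) h2
  simp only [← mul_assoc, hs, one_mul] at h4
  rw [h4]
  congr 1; funext y; simp only [smul_eq_mul]; ring

/-- Translations commute with convolution, and averaging against a probability density does not
increase the `Lᵖ` norm. Mollified derivatives therefore inherit the increment bounds uniformly in
the mollifier. -/
theorem eLpNorm_translate_sub_convolution_le {ρ g : Plane → ℝ} (hρ : Continuous ρ)
    (hc : HasCompactSupport ρ) (hρ0 : ∀ x, 0 ≤ ρ x) (hρ1 : ∫ x, ρ x = 1)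
    (hg : LocallyIntegrable g volume) {p : ℝ≥0∞} (hp : 1 ≤ p) (h : Plane) :
    eLpNorm (fun x => (ρ ⋆[ContinuousLinearMap.lsmul ℝ ℝ] g) (x - h) -
      (ρ ⋆[ContinuousLinearMap.lsmul ℝ ℝ] g) x) p volume ≤
      eLpNorm (fun x => g (x - h) - g x) p volume := by
  have hex : ∀ x, Integrable (fun y => ρ y * g (x - y)) volume := fun x =>
    hc.convolutionExists_left (ContinuousLinearMap.lsmul ℝ ℝ) hρ hg x
  have e1 : (fun x => (ρ ⋆[ContinuousLinearMap.lsmul ℝ ℝ] g) (x - h) -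
      (ρ ⋆[ContinuousLinearMap.lsmul ℝ ℝ] g) x) =
      fun x => ∫ y, ρ y * (g (x - y - h) - g (x - y)) := by
    funext x
    simp only [convolution_lsmul, smul_eq_mul]
    rw [← integral_sub (hex (x - h)) (hex x)]
    congr 1; funext y
    rw [show x - h - y = x - y - h by abel]; ring
  have hgm : AEStronglyMeasurable (fun x => g (x - h) - g x) volume := by
    refine AEStronglyMeasurable.sub ?_ hg.aestronglyMeasurable
    exact hg.aestronglyMeasurable.comp_measurePreserving (measurePreserving_sub_right volume h)
  have hqmp : Measure.QuasiMeasurePreserving (fun z : Plane × Plane => z.1 - z.2)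
      (volume.prod volume) volume := quasiMeasurePreserving_sub volume volume
  rw [e1]
  have hint : Integrable ρ volume := hρ.integrable_of_hasCompactSupport hc
  refine (eLpNorm_integral_le hp
    (b := fun y => ENNReal.ofReal (ρ y) * eLpNorm (fun x => g (x - h) - g x) p volume)
    ?_ ?_ (ae_of_all _ fun y => ?_)).trans ?_
  · exact (hρ.comp continuous_snd).aestronglyMeasurable.mul
      (hgm.comp_quasiMeasurePreserving hqmp)
  · exact (hρ.measurable.ennreal_ofReal.mul_const _).aemeasurable
  · change eLpNorm (ρ y • fun x => g (x - y - h) - g (x - y)) p volume ≤ _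
    rw [eLpNorm_const_smul, Real.enorm_of_nonneg (hρ0 y)]
    gcongr
    exact (eLpNorm_comp_measurePreserving hgm (measurePreserving_sub_right volume y)).le
  · rw [lintegral_mul_const _ hρ.measurable.ennreal_ofReal,
      ← ofReal_integral_eq_lintegral_ofReal hint (ae_of_all _ hρ0), hρ1]
    simp

end Mollification

/-! ### Taylor remainder in `Lᵖ` -/

section Taylor

open scoped ContDiff Nat

/-- The product rule makes the sum telescope: differentiating `(1 - s)^k / k!` cancels the
derivative of `P (k - 1)`, and only the top term survives. -/
theorem hasDerivAt_sum_taylor {P : ℕ → ℝ → ℝ} (hP : ∀ k s, HasDerivAt (P k) (P (k + 1) s) s)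
    (m : ℕ) (s : ℝ) :
    HasDerivAt (fun s => ∑ k ∈ Finset.range (m + 1), (1 - s) ^ k / k ! * P k s)
      ((1 - s) ^ m / m ! * P (m + 1) s) s := by
  induction m with
  | zero => simpa using hP 0 s
  | succ m ih =>
    have h1 : HasDerivAt (fun s : ℝ => (1 - s) ^ (m + 1) / (m + 1)!)
        (-((1 - s) ^ m / m !)) s := by
      have := ((((hasDerivAt_id s).const_sub 1).pow (m + 1)).div_const ((m + 1)! : ℝ))
      refine this.congr_deriv ?_
      rw [Nat.factorial_succ]
      push_cast
      simp only [id]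
      have : ((m : ℝ) + 1) ≠ 0 := by positivity
      have : (m ! : ℝ) ≠ 0 := by positivity
      field_simp
    have h2 := ih.add (h1.mul (hP (m + 1) s))
    simp only [Finset.sum_range_succ _ (m + 1)]
    refine h2.congr_deriv ?_
    ring

theorem taylor_integral_sequence {P : ℕ → ℝ → ℝ} (hP : ∀ k s, HasDerivAt (P k) (P (k + 1) s) s)
    (m : ℕ) :
    P 0 1 = ∑ k ∈ Finset.range (m + 1), P k 0 / k ! +
      ∫ s in (0 : ℝ)..1, (1 - s) ^ m / m ! * P (m + 1) s := by
  have hcont : Continuous (P (m + 1)) :=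
    continuous_iff_continuousAt.2 fun s => (hP (m + 1) s).continuousAt
  rw [intervalIntegral.integral_eq_sub_of_hasDerivAt (fun s _ => hasDerivAt_sum_taylor hP m s)
    (Continuous.intervalIntegrable (by fun_prop) _ _)]
  have h1 : ∑ k ∈ Finset.range (m + 1), (1 - (1 : ℝ)) ^ k / k ! * P k 1 = P 0 1 := by
    rw [Finset.sum_range_succ']
    simp
  rw [h1]
  have h0 : ∑ k ∈ Finset.range (m + 1), (1 - (0 : ℝ)) ^ k / k ! * P k 0 =
      ∑ k ∈ Finset.range (m + 1), P k 0 / k ! := by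
    refine Finset.sum_congr rfl fun k _ => ?_
    rw [sub_zero, one_pow]; ring
  rw [h0]; ring

/-- The `k`-th derivative of `u` at `x` in direction `v`, expanded in partial derivatives. -/
noncomputable def dirDeriv (k : ℕ) (u : Plane → ℝ) (x v : Plane) : ℝ :=
  ∑ j ∈ Finset.HasAntidiagonal.antidiagonal k, (k.choose j.1 : ℝ) * (v 0 ^ j.1 * v 1 ^ j.2 * multiD j u x)

theorem dirDeriv_zero (u : Plane → ℝ) (x v : Plane) : dirDeriv 0 u x v = u x := by
  simp [dirDeriv, multiD]

theorem continuous_dirDeriv {u : Plane → ℝ} (hu : ContDiff ℝ ∞ u) (k : ℕ) :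
    Continuous (fun z : Plane × Plane => dirDeriv k u z.1 z.2) := by
  unfold dirDeriv
  refine continuous_finsetSum _ fun j _ => ?_
  have := (contDiff_multiD hu j).continuous
  fun_prop

theorem fderiv_apply_eq_partialD (w : Plane → ℝ) (x v : Plane) :
    fderiv ℝ w x v = v 0 * partialD 0 w x + v 1 * partialD 1 w x := by
  have hv : v = v 0 • EuclideanSpace.single (0 : Fin 2) (1 : ℝ) +
      v 1 • EuclideanSpace.single (1 : Fin 2) (1 : ℝ) := by
    ext i; fin_cases i <;> simp
  conv_lhs => rw [hv, map_add, map_smul, map_smul]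
  rfl

theorem hasDerivAt_dirDeriv {u : Plane → ℝ} (hu : ContDiff ℝ ∞ u) (x v : Plane) (k : ℕ) (s : ℝ) :
    HasDerivAt (fun s : ℝ => dirDeriv k u (x + s • v) v) (dirDeriv (k + 1) u (x + s • v) v) s := by
  have hj : ∀ j : ℕ × ℕ, HasDerivAt (fun s : ℝ => multiD j u (x + s • v))
      (v 0 * multiD (j.1 + 1, j.2) u (x + s • v) + v 1 * multiD (j.1, j.2 + 1) u (x + s • v)) s := by
    intro j
    have h1 : HasDerivAt (fun s : ℝ => x + s • v) v s := by
      simpa using ((hasDerivAt_id s).smul_const v).const_add x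
    have h2 := ((contDiff_multiD hu j).differentiable (by simp)
      (x + s • v)).hasFDerivAt.comp_hasDerivAt s h1
    rw [fderiv_apply_eq_partialD] at h2
    rw [← partialD_zero_multiD, ← partialD_one_multiD hu]
    exact h2
  have h := HasDerivAt.fun_sum (u := Finset.HasAntidiagonal.antidiagonal k) fun j _ =>
    ((hj j).const_mul (v 0 ^ j.1 * v 1 ^ j.2)).const_mul (k.choose j.1 : ℝ)
  refine h.congr_deriv ?_
  unfold dirDeriv
  -- Pascal's rule for the binomial weights of order `k + 1`.
  rw [Finset.sum_antidiagonal_choose_succ_mul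
    (fun a b => v 0 ^ a * v 1 ^ b * multiD (a, b) u (x + s • v)), ← Finset.sum_add_distrib]
  refine Finset.sum_congr rfl fun j hj => ?_
  rw [Finset.HasAntidiagonal.mem_antidiagonal] at hj
  rw [show k.choose j.2 = k.choose j.1 by rw [← hj, Nat.choose_symm_add]]
  ring

/-- The remainder of the Taylor expansion of order `n` of `u` at `x`. -/
noncomputable def taylorRem (n : ℕ) (u : Plane → ℝ) (x v : Plane) : ℝ :=
  u (x + v) - ∑ k ∈ Finset.range (n + 1), dirDeriv k u x v / k !

/-- Since `∫₀¹ (1 - s)^m / m! ds = 1 / (m+1)!`, the Taylor term of order `m + 1` can be absorbed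
into the integral remainder. What is left are increments of the top-order derivatives, the
quantities controlled by a fractional seminorm. -/
theorem taylorRem_succ {u : Plane → ℝ} (hu : ContDiff ℝ ∞ u) (m : ℕ) (x v : Plane) :
    taylorRem (m + 1) u x v = ∫ s in Set.Ioc (0 : ℝ) 1,
      (1 - s) ^ m / m ! * (dirDeriv (m + 1) u (x + s • v) v - dirDeriv (m + 1) u x v) := by
  rw [← intervalIntegral.integral_of_le zero_le_one]
  have h := taylor_integral_sequence (P := fun k s => dirDeriv k u (x + s • v) v)
    (fun k s => hasDerivAt_dirDeriv hu x v k s) m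
  simp only [dirDeriv_zero, one_smul, zero_smul, add_zero] at h
  have hc : Continuous fun s : ℝ => dirDeriv (m + 1) u (x + s • v) v :=
    (continuous_dirDeriv hu (m + 1)).comp (f := fun s : ℝ => (x + s • v, v)) (by fun_prop)
  have hI : ∫ s in (0 : ℝ)..1, (1 - s) ^ m / m ! = 1 / (m + 1)! := by
    -- The same formula, applied to the successive derivatives of `s^(m+1) / (m+1)!`: all of order
    -- at most `m` vanish at `0`, and the one of order `m + 1` is `1`.
    have := taylor_integral_sequence (P := fun k s => if k ≤ m + 1 then
      s ^ (m + 1 - k) / (m + 1 - k)! else 0) (fun k s => ?_) m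
    · simp only [le_refl, if_true, Nat.sub_self, pow_zero, Nat.factorial_zero] at this
      rw [Finset.sum_eq_zero] at this
      · simpa using this.symm
      · intro k hk
        rw [Finset.mem_range] at hk
        rw [if_pos hk.le, zero_pow (by omega)]; simp
    · rcases lt_trichotomy k (m + 1) with hk | rfl | hk
      · obtain ⟨d, hd⟩ : ∃ d, m + 1 - k = d + 1 := ⟨m - k, by omega⟩
        simp only [if_pos hk.le, if_pos (Nat.succ_le_of_lt hk), hd,
          show m + 1 - (k + 1) = d by omega]
        refine ((hasDerivAt_pow (d + 1) s).div_const ((d + 1)! : ℝ)).congr_deriv ?_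
        rw [Nat.factorial_succ]; push_cast
        have : ((d : ℝ) + 1) ≠ 0 := by positivity
        have : (d ! : ℝ) ≠ 0 := by positivity
        field_simp
      · simpa using hasDerivAt_const s (1 : ℝ)
      · simpa [not_le.2 hk, not_le.2 (hk.trans (Nat.lt_succ_self k))] using hasDerivAt_const s (0 : ℝ)
  have hsplit : ∫ s in (0 : ℝ)..1, (1 - s) ^ m / m ! *
        (dirDeriv (m + 1) u (x + s • v) v - dirDeriv (m + 1) u x v) =
      (∫ s in (0 : ℝ)..1, (1 - s) ^ m / m ! * dirDeriv (m + 1) u (x + s • v) v) -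
        1 / (m + 1)! * dirDeriv (m + 1) u x v := by
    rw [← hI, ← intervalIntegral.integral_mul_const, ← intervalIntegral.integral_sub]
    · congr 1; funext s; ring
    · exact Continuous.intervalIntegrable (by fun_prop) _ _
    · exact Continuous.intervalIntegrable (by fun_prop) _ _
  rw [hsplit, taylorRem, Finset.sum_range_succ, h]
  ring

/-- The beta density with parameters `θ + 1` and `m + 1` has total mass one. With `α = m + 1 + θ`
the denominator is `Γ(α + 1)`, the source of the Gamma quotient in `cApprox`. -/
theorem lintegral_beta {θ : ℝ} (hθ : 0 < θ) (m : ℕ) :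
    ∫⁻ s in Set.Ioc (0 : ℝ) 1, ENNReal.ofReal ((1 - s) ^ m * s ^ θ) =
      ENNReal.ofReal (m ! * Real.Gamma (θ + 1) / Real.Gamma (m + 1 + θ + 1)) := by
  have hb : 0 < ProbabilityTheory.beta (θ + 1) (m + 1) :=
    ProbabilityTheory.beta_pos (by linarith) (by positivity)
  have h := ProbabilityTheory.lintegral_betaPDF_eq_one (α := θ + 1) (β := m + 1) (by linarith)
    (by positivity)
  have h2 : ∫⁻ s, ProbabilityTheory.betaPDF (θ + 1) (m + 1) s =
      ENNReal.ofReal (1 / ProbabilityTheory.beta (θ + 1) (m + 1)) *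
        ∫⁻ s in Set.Ioc (0 : ℝ) 1, ENNReal.ofReal ((1 - s) ^ m * s ^ θ) := by
    rw [← lintegral_const_mul _ (by fun_prop),
      setLIntegral_congr (Ioo_ae_eq_Ioc (μ := volume)).symm, ← lintegral_indicator measurableSet_Ioo]
    refine lintegral_congr fun s => ?_
    rw [ProbabilityTheory.betaPDF, ProbabilityTheory.betaPDFReal, Set.indicator_apply]
    simp only [Set.mem_Ioo]
    split_ifs with hs
    · rw [← ENNReal.ofReal_mul (by positivity)]
      congr 1
      simp only [add_sub_cancel_right, Real.rpow_natCast]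
      ring
    · simp
  rw [h2] at h
  have h3 : ENNReal.ofReal (ProbabilityTheory.beta (θ + 1) (m + 1)) *
      ENNReal.ofReal (1 / ProbabilityTheory.beta (θ + 1) (m + 1)) = 1 := by
    rw [← ENNReal.ofReal_mul hb.le, mul_one_div_cancel hb.ne']; simp
  have h4 := congrArg (fun z => ENNReal.ofReal (ProbabilityTheory.beta (θ + 1) (m + 1)) * z) h
  simp only [← mul_assoc, h3, one_mul, mul_one] at h4
  rw [h4, ProbabilityTheory.beta, Real.Gamma_nat_eq_factorial]
  congr 2
  · ring
  · congr 1; ring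

theorem abs_monomial_le_norm_pow (v : Plane) (j : ℕ × ℕ) :
    |v 0 ^ j.1 * v 1 ^ j.2| ≤ ‖v‖ ^ (j.1 + j.2) := by
  rw [abs_mul, abs_pow, abs_pow, pow_add]
  gcongr
  · exact PiLp.norm_apply_le v 0
  · exact PiLp.norm_apply_le v 1

theorem eLpNorm_dirDeriv_sub_le {u : Plane → ℝ} (hu : ContDiff ℝ ∞ u) {p : ℝ≥0∞} (hp : 1 ≤ p)
    {n : ℕ} {θ c : ℝ} {N : ℕ × ℕ → ℝ≥0∞}
    (hN : ∀ j ∈ Finset.HasAntidiagonal.antidiagonal n, ∀ h : Plane,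
      eLpNorm (fun x => multiD j u (x - h) - multiD j u x) p volume ≤
        ENNReal.ofReal (c * ‖h‖ ^ θ) * N j) (v h : Plane) :
    eLpNorm (fun x => dirDeriv n u (x - h) v - dirDeriv n u x v) p volume ≤
      ENNReal.ofReal (‖v‖ ^ n * (c * ‖h‖ ^ θ)) *
        ∑ j ∈ Finset.HasAntidiagonal.antidiagonal n, (n.choose j.1 : ℝ≥0∞) * N j := by
  have e : (fun x => dirDeriv n u (x - h) v - dirDeriv n u x v) =
      ∑ j ∈ Finset.HasAntidiagonal.antidiagonal n, ((n.choose j.1 : ℝ) * (v 0 ^ j.1 * v 1 ^ j.2)) •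
        fun x => multiD j u (x - h) - multiD j u x := by
    funext x
    simp only [dirDeriv, Finset.sum_apply, Pi.smul_apply, smul_eq_mul]
    rw [← Finset.sum_sub_distrib]
    exact Finset.sum_congr rfl fun j _ => by ring
  rw [e]
  refine (eLpNorm_sum_le (fun j _ => ?_) hp).trans ?_
  · have := (contDiff_multiD hu j).continuous
    exact (Continuous.aestronglyMeasurable (by fun_prop)).const_smul _
  rw [Finset.mul_sum]
  refine Finset.sum_le_sum fun j hj => ?_
  rw [eLpNorm_const_smul, Real.enorm_eq_ofReal_abs, abs_mul,
    ENNReal.ofReal_mul (abs_nonneg _), Nat.abs_cast, ENNReal.ofReal_natCast]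
  have h1 := hN j hj h
  have h2 : ENNReal.ofReal |v 0 ^ j.1 * v 1 ^ j.2| ≤ ENNReal.ofReal (‖v‖ ^ n) := by
    gcongr
    rw [← Finset.HasAntidiagonal.mem_antidiagonal.1 hj]
    exact abs_monomial_le_norm_pow v j
  calc _ ≤ (n.choose j.1 : ℝ≥0∞) * ENNReal.ofReal (‖v‖ ^ n) *
        (ENNReal.ofReal (c * ‖h‖ ^ θ) * N j) := by gcongr
    _ = _ := by rw [ENNReal.ofReal_mul (p := ‖v‖ ^ n) (by positivity)]; ring

/-- For `n = 0` the remainder is itself an increment. For `n = m + 1`, Minkowski is applied to the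
integral form: the shift by `s • v` contributes `s^θ ‖v‖^θ`, the direction contributes `‖v‖^n`, and
the beta integral in `s` produces an `m!` that cancels the one in the remainder. -/
theorem eLpNorm_taylorRem_le {u : Plane → ℝ} (hu : ContDiff ℝ ∞ u) {p : ℝ≥0∞} (hp : 1 ≤ p)
    {n : ℕ} {θ c : ℝ} (hθ : 0 < θ) (hc : 0 ≤ c) {N : ℕ × ℕ → ℝ≥0∞}
    (hN : ∀ j ∈ Finset.HasAntidiagonal.antidiagonal n, ∀ h : Plane,
      eLpNorm (fun x => multiD j u (x - h) - multiD j u x) p volume ≤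
        ENNReal.ofReal (c * ‖h‖ ^ θ) * N j) (v : Plane) :
    eLpNorm (fun x => taylorRem n u x v) p volume ≤
      ENNReal.ofReal (c * (Real.Gamma (θ + 1) / Real.Gamma (n + θ + 1)) * ‖v‖ ^ (n + θ)) *
        ∑ j ∈ Finset.HasAntidiagonal.antidiagonal n, (n.choose j.1 : ℝ≥0∞) * N j := by
  have hd := eLpNorm_dirDeriv_sub_le hu hp hN v
  set S := ∑ j ∈ Finset.HasAntidiagonal.antidiagonal n, (n.choose j.1 : ℝ≥0∞) * N j
  cases n with
  | zero =>
    have h := hd (-v)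
    simp only [dirDeriv_zero, sub_neg_eq_add, norm_neg, pow_zero, one_mul] at h
    have hg : Real.Gamma (θ + 1) ≠ 0 := (Real.Gamma_pos_of_pos (by linarith)).ne'
    simpa [taylorRem, dirDeriv_zero, hg] using h
  | succ m =>
    have hΓ1 : 0 < Real.Gamma (θ + 1) := Real.Gamma_pos_of_pos (by linarith)
    have hΓ2 : 0 < Real.Gamma ((m : ℝ) + 1 + θ + 1) := Real.Gamma_pos_of_pos (by positivity)
    simp only [taylorRem_succ hu]
    refine (eLpNorm_integral_le hp (b := fun s => ENNReal.ofReal ((1 - s) ^ m * s ^ θ) *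
      (ENNReal.ofReal (‖v‖ ^ (m + 1) * (c * ‖v‖ ^ θ) / m !) * S)) ?_ ?_ ?_).trans ?_
    · have h1 : Continuous fun z : Plane × ℝ => dirDeriv (m + 1) u (z.1 + z.2 • v) v :=
        (continuous_dirDeriv hu (m + 1)).comp (f := fun z : Plane × ℝ => (z.1 + z.2 • v, v))
          (by fun_prop)
      have h2 : Continuous fun z : Plane × ℝ => dirDeriv (m + 1) u z.1 v :=
        (continuous_dirDeriv hu (m + 1)).comp (f := fun z : Plane × ℝ => (z.1, v)) (by fun_prop)
      refine Continuous.aestronglyMeasurable ?_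
      simp only [Function.uncurry_def]
      fun_prop
    · exact (Measurable.mul_const (by fun_prop) _).aemeasurable
    · filter_upwards [ae_restrict_mem measurableSet_Ioc] with s hs
      have h0 : 0 ≤ (1 - s) ^ m := pow_nonneg (by linarith [hs.2]) _
      change eLpNorm (((1 - s) ^ m / m !) • fun x => dirDeriv (m + 1) u (x + s • v) v -
        dirDeriv (m + 1) u x v) p volume ≤ _
      rw [eLpNorm_const_smul, Real.enorm_of_nonneg (by positivity)]
      have h := hd (-(s • v))
      simp only [sub_neg_eq_add, norm_neg, norm_smul, Real.norm_eq_abs, abs_of_pos hs.1] at h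
      calc _ ≤ ENNReal.ofReal ((1 - s) ^ m / m !) *
            (ENNReal.ofReal (‖v‖ ^ (m + 1) * (c * (s * ‖v‖) ^ θ)) * S) := by gcongr
        _ = _ := by
          rw [← mul_assoc, ← ENNReal.ofReal_mul (by positivity),
            ← mul_assoc (ENNReal.ofReal ((1 - s) ^ m * s ^ θ)), ← ENNReal.ofReal_mul (mul_nonneg h0 (Real.rpow_nonneg hs.1.le _)),
            Real.mul_rpow hs.1.le (norm_nonneg _)]
          congr 2; ring
    · rw [lintegral_mul_const _ (by fun_prop), lintegral_beta hθ, ← mul_assoc,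
        ← ENNReal.ofReal_mul (by positivity)]
      push_cast
      refine mul_le_mul_left (ENNReal.ofReal_le_ofReal ?_) _
      rw [Real.rpow_add_of_nonneg (norm_nonneg _) (by positivity) hθ.le,
        show ((m : ℝ) + 1) = ((m + 1 : ℕ) : ℝ) by push_cast; ring, Real.rpow_natCast]
      have : (m ! : ℝ) ≠ 0 := by positivity
      apply le_of_eq
      field_simp

end Taylor

/-! ### Approximation by kernels with vanishing moments -/

section Approximation

open scoped ContDiff Nat Convolution

/-- Domination by `1 + ‖x‖^α`, treating `‖x‖ ≤ 1` and `‖x‖ ≥ 1` separately. -/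
theorem integrable_monomial_smul {k : Plane → ℂ} {α : ℝ} (hk : Integrable k volume)
    (hkα : Integrable (fun x : Plane => ‖x‖ ^ α * ‖k x‖) volume) {j : ℕ × ℕ}
    (hj : ((j.1 + j.2 : ℕ) : ℝ) ≤ α) :
    Integrable (fun x : Plane => (x 0 ^ j.1 * x 1 ^ j.2) • k x) volume := by
  refine (hk.norm.add hkα).mono' ?_ (ae_of_all _ fun x => ?_)
  · have hc : Continuous fun x : Plane => x 0 ^ j.1 * x 1 ^ j.2 := by fun_prop
    exact hc.aestronglyMeasurable.smul hk.aestronglyMeasurable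
  · rw [norm_smul, Real.norm_eq_abs, Pi.add_apply]
    have h1 := abs_monomial_le_norm_pow x j
    have h2 : ‖x‖ ^ (j.1 + j.2) ≤ 1 + ‖x‖ ^ α := by
      rcases le_total ‖x‖ 1 with h | h
      · have := pow_le_one₀ (norm_nonneg x) h (n := j.1 + j.2)
        have := Real.rpow_nonneg (norm_nonneg x) α
        linarith
      · have := Real.rpow_le_rpow_of_exponent_le h hj
        rw [Real.rpow_natCast] at this
        linarith
    calc _ ≤ (1 + ‖x‖ ^ α) * ‖k x‖ := by gcongr; exact h1.trans h2
      _ = _ := by ring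

theorem mul_dirDeriv_neg (k : Plane → ℂ) (u : Plane → ℝ) (i : ℕ) (x y : Plane) :
    k y * ((dirDeriv i u x (-y) : ℝ) : ℂ) = ∑ j ∈ Finset.HasAntidiagonal.antidiagonal i,
      ((i.choose j.1 * ((-1) ^ i * multiD j u x) : ℝ) : ℂ) * ((y 0 ^ j.1 * y 1 ^ j.2) • k y) := by
  rw [dirDeriv, Complex.ofReal_sum, Finset.mul_sum]
  refine Finset.sum_congr rfl fun j hj => ?_
  rw [Finset.HasAntidiagonal.mem_antidiagonal] at hj
  rw [← hj, pow_add, Complex.real_smul]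
  simp only [PiLp.neg_apply]
  rw [neg_pow (y 0), neg_pow (y 1)]
  push_cast
  ring

theorem integrable_mul_dirDeriv_neg {k : Plane → ℂ} {α : ℝ} (hk : Integrable k volume)
    (hkα : Integrable (fun x : Plane => ‖x‖ ^ α * ‖k x‖) volume) {i : ℕ} (hi : (i : ℝ) ≤ α)
    (u : Plane → ℝ) (x : Plane) :
    Integrable (fun y => k y * ((dirDeriv i u x (-y) : ℝ) : ℂ)) volume := by
  simp only [mul_dirDeriv_neg]
  refine integrable_finsetSum _ fun j hj => (integrable_monomial_smul hk hkα ?_).const_mul _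
  rwa [Finset.HasAntidiagonal.mem_antidiagonal.1 hj]

theorem integral_mul_dirDeriv_neg {k : Plane → ℂ} {α : ℝ} (hk : Integrable k volume)
    (hkα : Integrable (fun x : Plane => ‖x‖ ^ α * ‖k x‖) volume) {i : ℕ} (hi : (i : ℝ) ≤ α)
    (hmom : ∀ j₁ j₂ : ℕ, j₁ + j₂ = i → ∫ x : Plane, (x 0 ^ j₁ * x 1 ^ j₂) • k x = 0)
    (u : Plane → ℝ) (x : Plane) :
    ∫ y, k y * ((dirDeriv i u x (-y) : ℝ) : ℂ) = 0 := by
  simp only [mul_dirDeriv_neg]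
  rw [integral_finsetSum]
  · refine Finset.sum_eq_zero fun j hj => ?_
    rw [integral_const_mul, hmom _ _ (Finset.HasAntidiagonal.mem_antidiagonal.1 hj), mul_zero]
  · refine fun j hj => (integrable_monomial_smul hk hkα ?_).const_mul _
    rwa [Finset.HasAntidiagonal.mem_antidiagonal.1 hj]

/-- Against `k`, the Taylor polynomial of `y ↦ u (x - y)` integrates to `u x`: the constant term has
weight `∫ k = 1` and the moment conditions remove the others. Boundedness of `u` makes the
convolution integral converge. -/
theorem integral_mul_taylorRem_neg {u : Plane → ℝ} (hu : ContDiff ℝ ∞ u) {C : ℝ}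
    (hC : ∀ x, |u x| ≤ C) {k : Plane → ℂ} {n : ℕ} {α : ℝ} (hα : (n : ℝ) ≤ α)
    (hk : Integrable k volume) (hk1 : ∫ x, k x = 1)
    (hkα : Integrable (fun x : Plane => ‖x‖ ^ α * ‖k x‖) volume)
    (hmom : ∀ j₁ j₂ : ℕ, 1 ≤ j₁ + j₂ → j₁ + j₂ ≤ n →
      ∫ x : Plane, (x 0 ^ j₁ * x 1 ^ j₂) • k x = 0) (x : Plane) :
    ∫ y, k y * ((taylorRem n u x (-y) : ℝ) : ℂ) = (∫ y, k y * (u (x - y) : ℂ)) - u x := by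
  have hle : ∀ i ∈ Finset.range (n + 1), (i : ℝ) ≤ α := fun i hi => by
    have : i ≤ n := Nat.lt_succ_iff.1 (Finset.mem_range.1 hi)
    exact le_trans (by exact_mod_cast this) hα
  have hint : ∀ i ∈ Finset.range (n + 1),
      Integrable (fun y => k y * ((dirDeriv i u x (-y) : ℝ) : ℂ) / (i ! : ℂ)) volume :=
    fun i hi => (integrable_mul_dirDeriv_neg hk hkα (hle i hi) u x).div_const _
  have hu' : Integrable (fun y => k y * (u (x - y) : ℂ)) volume := by
    refine hk.mul_bdd (c := C) ?_ (ae_of_all _ fun y => ?_)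
    · have := hu.continuous
      exact Continuous.aestronglyMeasurable (by fun_prop)
    · simpa using hC (x - y)
  have e : (fun y => k y * ((taylorRem n u x (-y) : ℝ) : ℂ)) = fun y => k y * (u (x - y) : ℂ) -
      ∑ i ∈ Finset.range (n + 1), k y * ((dirDeriv i u x (-y) : ℝ) : ℂ) / (i ! : ℂ) := by
    funext y
    simp only [taylorRem, ← sub_eq_add_neg]
    push_cast
    rw [mul_sub, Finset.mul_sum]
    simp only [mul_div_assoc]
  rw [e, integral_sub hu' (integrable_finsetSum _ hint), integral_finsetSum _ hint,
    Finset.sum_range_succ', Finset.sum_eq_zero]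
  · simp only [dirDeriv_zero]
    rw [integral_div, integral_mul_const, hk1]
    simp
  · intro i hi
    have hi' : i + 1 ≤ n := Finset.mem_range.1 hi
    rw [integral_div, integral_mul_dirDeriv_neg hk hkα
      (hle (i + 1) (Finset.mem_range.2 (by omega))), zero_div]
    exact fun j₁ j₂ hj => hmom j₁ j₂ (by omega) (by omega)

theorem eLpNorm_sub_convolution_le_of_smooth {u : Plane → ℝ} (hu : ContDiff ℝ ∞ u) {C : ℝ}
    (hC : ∀ x, |u x| ≤ C) {k : Plane → ℂ} {n : ℕ} {θ c : ℝ} (hθ : 0 < θ) (hc : 0 ≤ c)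
    {p : ℝ≥0∞} (hp : 1 ≤ p) {N : ℕ × ℕ → ℝ≥0∞}
    (hN : ∀ j ∈ Finset.HasAntidiagonal.antidiagonal n, ∀ h : Plane,
      eLpNorm (fun x => multiD j u (x - h) - multiD j u x) p volume ≤
        ENNReal.ofReal (c * ‖h‖ ^ θ) * N j)
    (hk : Integrable k volume) (hk1 : ∫ x, k x = 1)
    (hkα : Integrable (fun x : Plane => ‖x‖ ^ (n + θ) * ‖k x‖) volume)
    (hmom : ∀ j₁ j₂ : ℕ, 1 ≤ j₁ + j₂ → j₁ + j₂ ≤ n →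
      ∫ x : Plane, (x 0 ^ j₁ * x 1 ^ j₂) • k x = 0) :
    eLpNorm (fun x => (u x : ℂ) - ∫ y, k y * (u (x - y) : ℂ)) p volume ≤
      ENNReal.ofReal (c * (Real.Gamma (θ + 1) / Real.Gamma (n + θ + 1)) *
        ∫ x : Plane, ‖x‖ ^ (n + θ) * ‖k x‖) *
        ∑ j ∈ Finset.HasAntidiagonal.antidiagonal n, (n.choose j.1 : ℝ≥0∞) * N j := by
  have hΓ1 : 0 < Real.Gamma (θ + 1) := Real.Gamma_pos_of_pos (by linarith)
  have hΓ2 : 0 < Real.Gamma (n + θ + 1) := Real.Gamma_pos_of_pos (by positivity)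
  have e : (fun x => (u x : ℂ) - ∫ y, k y * (u (x - y) : ℂ)) =
      -fun x => ∫ y, k y * ((taylorRem n u x (-y) : ℝ) : ℂ) := by
    funext x
    rw [Pi.neg_apply, integral_mul_taylorRem_neg hu hC (by linarith) hk hk1 hkα hmom]
    ring
  rw [e, eLpNorm_neg]
  set S := ∑ j ∈ Finset.HasAntidiagonal.antidiagonal n, (n.choose j.1 : ℝ≥0∞) * N j
  set G := Real.Gamma (θ + 1) / Real.Gamma (n + θ + 1)
  have hm : AEMeasurable (fun y : Plane => ENNReal.ofReal (‖y‖ ^ (n + θ) * ‖k y‖)) volume :=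
    hkα.aestronglyMeasurable.aemeasurable.ennreal_ofReal
  refine (eLpNorm_integral_le hp (b := fun y => ENNReal.ofReal (‖y‖ ^ (n + θ) * ‖k y‖) *
    (ENNReal.ofReal (c * G) * S)) ?_ (hm.mul_const _) (ae_of_all _ fun y => ?_)).trans ?_
  · have hc : Continuous fun z : Plane × Plane => taylorRem n u z.1 (-z.2) := by
      unfold taylorRem
      refine Continuous.sub (hu.continuous.comp (by fun_prop))
        (continuous_finsetSum _ fun i _ => Continuous.div_const ?_ _)
      exact (continuous_dirDeriv hu i).comp (f := fun z : Plane × Plane => (z.1, -z.2))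
        (by fun_prop)
    exact hk.aestronglyMeasurable.comp_snd.mul
      (Complex.continuous_ofReal.comp hc).aestronglyMeasurable
  · change eLpNorm (k y • fun x => ((taylorRem n u x (-y) : ℝ) : ℂ)) p volume ≤ _
    rw [eLpNorm_const_smul]
    have h1 : eLpNorm (fun x => ((taylorRem n u x (-y) : ℝ) : ℂ)) p volume =
        eLpNorm (fun x => taylorRem n u x (-y)) p volume :=
      eLpNorm_congr_norm_ae (ae_of_all _ fun x => by simp)
    have h2 := eLpNorm_taylorRem_le hu hp hθ hc hN (-y)
    rw [norm_neg] at h2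
    rw [h1, ← ofReal_norm]
    calc _ ≤ ENNReal.ofReal ‖k y‖ * (ENNReal.ofReal (c * G * ‖y‖ ^ (n + θ)) * S) := by gcongr
      _ = _ := by
        rw [← mul_assoc, ← mul_assoc, ← ENNReal.ofReal_mul (by positivity),
          ← ENNReal.ofReal_mul (by positivity)]
        congr 2; ring
  · rw [lintegral_mul_const'' _ hm, ← ofReal_integral_eq_lintegral_ofReal hkα
      (ae_of_all _ fun y => by positivity), ← mul_assoc, ← ENNReal.ofReal_mul, mul_comm (c * G)]
    exact integral_nonneg fun y => by positivity

theorem hasWeakDeriv_weakDeriv {j : ℕ × ℕ} {f : Plane → ℝ} (h : ∃ g, HasWeakDeriv j f g) :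
    HasWeakDeriv j f (weakDeriv j f) := by
  rw [weakDeriv, dif_pos h]
  exact h.choose_spec

/-- By Fubini, mollifying commutes with convolution by `k`, so the mollified error is the error of
the mollified function. -/
theorem convolution_sub_convolution {ρ f : Plane → ℝ} (hρ : Continuous ρ)
    (hc : HasCompactSupport ρ) (hf : Integrable f volume) {k : Plane → ℂ}
    (hk : Integrable k volume) (x : Plane)
    (hx : Integrable (fun t => ρ t • ∫ y, k y * (f (x - t - y) : ℂ)) volume) :
    (ρ ⋆[ContinuousLinearMap.lsmul ℝ ℝ] fun x => (f x : ℂ) - ∫ y, k y * (f (x - y) : ℂ)) x =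
      ((ρ ⋆[ContinuousLinearMap.lsmul ℝ ℝ] f) x : ℂ) -
        ∫ y, k y * ((ρ ⋆[ContinuousLinearMap.lsmul ℝ ℝ] f) (x - y) : ℂ) := by
  obtain ⟨C, hC⟩ := hρ.bounded_above_of_compact_support hc
  have h1 : ∀ z, (((ρ ⋆[ContinuousLinearMap.lsmul ℝ ℝ] f) z : ℝ) : ℂ) =
      ∫ t, ρ t • (f (z - t) : ℂ) := fun z => by
    rw [convolution_lsmul, ← integral_complex_ofReal]
    simp
  have hint1 : Integrable (fun t => ρ t • (f (x - t) : ℂ)) volume := by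
    exact Integrable.bdd_smul (hf.comp_sub_left x).ofReal C hρ.aestronglyMeasurable
      (ae_of_all _ hC)
  have hK : Integrable (fun z : Plane × Plane => k z.2 * (f (z.1 - z.2) : ℂ))
      (volume.prod volume) :=
    hk.convolution_integrand (ContinuousLinearMap.mul ℝ ℂ) hf.ofReal
  have hK' : Integrable (fun z : Plane × Plane => ρ z.1 • (k z.2 * (f (x - z.1 - z.2) : ℂ)))
      (volume.prod volume) := by
    exact Integrable.bdd_smul (((Measure.measurePreserving_sub_left volume x).prod
      (MeasurePreserving.id volume)).integrable_comp_of_integrable hK) C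
      (hρ.comp continuous_fst).aestronglyMeasurable (ae_of_all _ fun z => hC z.1)
  simp only [h1]
  rw [convolution_lsmul]
  simp only [smul_sub]
  rw [integral_sub hint1 hx]
  congr 1
  simp only [← integral_smul, ← integral_const_mul]
  rw [integral_integral_swap hK']
  congr 1; funext y; congr 1; funext t
  rw [show x - t - y = x - y - t by abel, mul_smul_comm]

/-- The smooth estimate holds for every mollification of `f` with the same right-hand side. The
mollified errors converge almost everywhere to the error of `f`, and Fatou's lemma concludes. -/
theorem eLpNorm_sub_convolution_le {f : Plane → ℝ} (hf : Integrable f volume)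
    {k : Plane → ℂ} {n : ℕ} {θ : ℝ} (hθ : 0 < θ)
    {p q : ℝ≥0∞} (hp : 1 ≤ p) (hq : 1 ≤ q) (hfB : besovSeminorm n θ p q f ≠ ⊤)
    (hk : Integrable k volume) (hk1 : ∫ x, k x = 1)
    (hkα : Integrable (fun x : Plane => ‖x‖ ^ (n + θ) * ‖k x‖) volume)
    (hmom : ∀ j₁ j₂ : ℕ, 1 ≤ j₁ + j₂ → j₁ + j₂ ≤ n →
      ∫ x : Plane, (x 0 ^ j₁ * x 1 ^ j₂) • k x = 0) :
    eLpNorm (fun x => (f x : ℂ) - ∫ y, k y * (f (x - y) : ℂ)) p volume ≤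
      ENNReal.ofReal (cFrac θ q * (Real.Gamma (θ + 1) / Real.Gamma (n + θ + 1)) *
        ∫ x : Plane, ‖x‖ ^ (n + θ) * ‖k x‖) * besovSeminorm n θ p q f := by
  have hw : ∀ j ∈ Finset.HasAntidiagonal.antidiagonal n, ∃ g, HasWeakDeriv j f g := by
    by_contra hcon
    exact hfB (by rw [besovSeminorm, if_neg hcon])
  rw [besovSeminorm, if_pos hw]
  have hconv : Integrable (fun x => ∫ y, k y * (f (x - y) : ℂ)) volume :=
    hk.integrable_convolution (ContinuousLinearMap.mul ℝ ℂ) hf.ofReal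
  have hr : Integrable (fun x => (f x : ℂ) - ∫ y, k y * (f (x - y) : ℂ)) volume :=
    hf.ofReal.sub hconv
  -- The fixed ratio `2` of outer to inner radius is what the Lebesgue differentiation argument
  -- behind `hlim` requires.
  let η : ℕ → ContDiffBump (0 : Plane) := fun i =>
    ⟨1 / ((i : ℝ) + 1), 2 * (1 / ((i : ℝ) + 1)), by positivity, by
      have : 0 < 1 / ((i : ℝ) + 1) := by positivity
      linarith⟩
  have hη0 : Tendsto (fun i => (η i).rOut) atTop (𝓝 0) := by
    have h := (tendsto_one_div_add_atTop_nhds_zero_nat (𝕜 := ℝ)).const_mul 2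
    rwa [mul_zero] at h
  have hlim := ContDiffBump.ae_convolution_tendsto_right_of_locallyIntegrable (K := 2) hη0
    (Eventually.of_forall fun i => le_rfl) hr.locallyIntegrable
  refine (Lp.eLpNorm_lim_le_liminf_eLpNorm (fun i => ?_) _ hlim).trans ?_
  · have hs := (η i).contDiff_normed (μ := volume) (n := 1)
    exact ((η i).hasCompactSupport_normed.continuous_convolution_left
      (ContinuousLinearMap.lsmul ℝ ℝ) hs.continuous
      hr.locallyIntegrable).aestronglyMeasurable
  refine (liminf_le_liminf (v := fun _ => _) (Eventually.of_forall fun i => ?_)).trans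
    (liminf_const _).le
  set ρ := (η i).normed volume
  have hρ : ContDiff ℝ ∞ ρ := (η i).contDiff_normed
  have hρc : HasCompactSupport ρ := (η i).hasCompactSupport_normed
  have e : (ρ ⋆[ContinuousLinearMap.lsmul ℝ ℝ] fun x => (f x : ℂ) - ∫ y, k y * (f (x - y) : ℂ)) =
      fun x => ((ρ ⋆[ContinuousLinearMap.lsmul ℝ ℝ] f) x : ℂ) -
        ∫ y, k y * ((ρ ⋆[ContinuousLinearMap.lsmul ℝ ℝ] f) (x - y) : ℂ) := by
    funext x
    exact convolution_sub_convolution hρ.continuous hρc hf hk x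
      (hρc.convolutionExists_left (ContinuousLinearMap.lsmul ℝ ℝ) hρ.continuous
        hconv.locallyIntegrable x)
  rw [e]
  obtain ⟨C, hC⟩ := hρ.continuous.bounded_above_of_compact_support hρc
  refine eLpNorm_sub_convolution_le_of_smooth
    (hρc.contDiff_convolution_left _ hρ hf.locallyIntegrable) (C := C * ∫ y, ‖f y‖) (fun x => ?_)
    hθ (cFrac_nonneg hθ q) hp (fun j hj h => ?_) hk hk1 hkα hmom
  · rw [convolution_lsmul_swap, ← Real.norm_eq_abs, ← integral_const_mul]
    refine norm_integral_le_of_norm_le (hf.norm.const_mul C) (ae_of_all _ fun y => ?_)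
    rw [norm_smul]
    gcongr
    exact hC _
  · have hwj := hasWeakDeriv_weakDeriv (hw j hj)
    rw [multiD_convolution hρ hρc hf.locallyIntegrable hwj]
    exact (eLpNorm_translate_sub_convolution_le hρ.continuous hρc (η i).nonneg_normed
      (η i).integral_normed hwj.1 hp h).trans (eLpNorm_translate_sub_le hθ hq _ h)

end Approximation

/-! ### Rotated coordinates on the plane -/

section Rotation

/-- Orthonormal coordinates `(t, s)` on the plane, adapted to the direction `(cos φ, sin φ)`. -/
noncomputable def rotEquiv (φ : ℝ) : ℝ × ℝ ≃ᵐ Plane where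
  toFun z := !₂[z.1 * Real.cos φ - z.2 * Real.sin φ, z.1 * Real.sin φ + z.2 * Real.cos φ]
  invFun x := (x 0 * Real.cos φ + x 1 * Real.sin φ, -x 0 * Real.sin φ + x 1 * Real.cos φ)
  left_inv z := by
    have h := Real.sin_sq_add_cos_sq φ
    ext
    · simp; linear_combination z.1 * h
    · simp; linear_combination z.2 * h
  right_inv x := by
    have h := Real.sin_sq_add_cos_sq φ
    ext i
    fin_cases i
    · simp; linear_combination x 0 * h
    · simp; linear_combination x 1 * h
  measurable_toFun := by
    refine Continuous.measurable ?_
    change Continuous fun z : ℝ × ℝ =>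
      !₂[z.1 * Real.cos φ - z.2 * Real.sin φ, z.1 * Real.sin φ + z.2 * Real.cos φ]
    fun_prop
  measurable_invFun := by
    refine Continuous.measurable ?_
    change Continuous fun x : Plane =>
      (x 0 * Real.cos φ + x 1 * Real.sin φ, -x 0 * Real.sin φ + x 1 * Real.cos φ)
    fun_prop

theorem rotEquiv_apply (φ : ℝ) (z : ℝ × ℝ) : rotEquiv φ z =
    !₂[z.1 * Real.cos φ - z.2 * Real.sin φ, z.1 * Real.sin φ + z.2 * Real.cos φ] := rfl

theorem rotEquiv_symm_apply (φ : ℝ) (x : Plane) : (rotEquiv φ).symm x =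
    (x 0 * Real.cos φ + x 1 * Real.sin φ, -x 0 * Real.sin φ + x 1 * Real.cos φ) := rfl

theorem measurePreserving_rotEquiv (φ : ℝ) : MeasurePreserving (rotEquiv φ) := by
  let M : Matrix (Fin 2) (Fin 2) ℝ := !![Real.cos φ, -Real.sin φ; Real.sin φ, Real.cos φ]
  have hdet : M.det = 1 := by
    simp only [M, Matrix.det_fin_two_of]
    linear_combination Real.sin_sq_add_cos_sq φ
  have hM : MeasurePreserving (Matrix.toLin' M) (volume : Measure (Fin 2 → ℝ)) volume := by
    refine ⟨(LinearMap.continuous_of_finiteDimensional _).measurable, ?_⟩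
    rw [Real.map_matrix_volume_pi_eq_smul_volume_pi (by rw [hdet]; exact one_ne_zero), hdet]
    simp
  have h := ((PiLp.volume_preserving_toLp (Fin 2)).comp hM).comp
    ((volume_preserving_finTwoArrow ℝ).symm _)
  have e : ⇑(rotEquiv φ) = (WithLp.toLp 2 ∘ ⇑(Matrix.toLin' M)) ∘
      ⇑(MeasurableEquiv.finTwoArrow (α := ℝ)).symm := by
    funext z
    rw [rotEquiv_apply]
    ext i
    fin_cases i
    · simp [M]; ring
    · simp [M]
  rw [e]
  exact h

theorem dist_rotEquiv (φ t s s' : ℝ) :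
    dist (rotEquiv φ (t, s)) (rotEquiv φ (t, s')) = dist s s' := by
  rw [EuclideanSpace.dist_eq, Fin.sum_univ_two]
  simp only [Real.dist_eq, sq_abs]
  rw [← Real.sqrt_sq_eq_abs]
  congr 1
  simp only [rotEquiv_apply, Matrix.cons_val_zero, Matrix.cons_val_one]
  linear_combination (s - s') ^ 2 * Real.sin_sq_add_cos_sq φ

end Rotation

/-! ### Dependence on the bandwidth -/

section Scaling

/-- One factor `L` comes from `A_L(LS) = L A(S)`, the other from the substitution `S ↦ LS`. -/
theorem invFourier_lowPass_scale (W : ℝ → ℝ) {L : ℝ} (hL : 0 < L) (t : ℝ) :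
    invFourier (lowPass W L) t = ((L ^ 2 : ℝ) : ℂ) * invFourier (lowPass W 1) (L * t) := by
  have h := Measure.integral_comp_mul_left
    (fun S : ℝ => ((lowPass W L S : ℝ) : ℂ) * Complex.exp (Complex.I * S * t)) L
  have e : (fun S : ℝ => ((lowPass W L (L * S) : ℝ) : ℂ) *
      Complex.exp (Complex.I * ((L * S : ℝ) : ℂ) * t)) = fun S : ℝ => (L : ℂ) *
      (((lowPass W 1 S : ℝ) : ℂ) * Complex.exp (Complex.I * S * ((L * t : ℝ) : ℂ))) := by
    funext S
    simp only [lowPass, abs_mul, abs_of_pos hL, mul_div_cancel_left₀ _ hL.ne', div_one]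
    push_cast
    rw [show Complex.I * (L * S) * t = Complex.I * S * (L * t) by ring]
    ring
  rw [e, integral_const_mul, abs_of_pos (inv_pos.2 hL)] at h
  have hL' : (L : ℂ) ≠ 0 := by exact_mod_cast hL.ne'
  have h2 : ∫ S : ℝ, ((lowPass W L S : ℝ) : ℂ) * Complex.exp (Complex.I * S * t) =
      (L : ℂ) ^ 2 * ∫ S : ℝ, ((lowPass W 1 S : ℝ) : ℂ) *
        Complex.exp (Complex.I * S * ((L * t : ℝ) : ℂ)) := by
    rw [sq, mul_assoc, h, Complex.real_smul]
    push_cast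
    rw [← mul_assoc, mul_inv_cancel₀ hL', one_mul]
  rw [invFourier, invFourier, h2, Complex.real_smul, Complex.real_smul]
  push_cast
  ring

theorem convKernel_scale (W : ℝ → ℝ) {L : ℝ} (hL : 0 < L) (x : Plane) :
    convKernel W L x = ((L ^ 2 : ℝ) : ℂ) * convKernel W 1 (L • x) := by
  simp only [convKernel, backProj, invFourier_lowPass_scale W hL]
  rw [intervalIntegral.integral_const_mul]
  simp only [PiLp.smul_apply, smul_eq_mul, Complex.real_smul]
  have : ∀ φ : ℝ, L * (x 0 * Real.cos φ + x 1 * Real.sin φ) =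
      L * x 0 * Real.cos φ + L * x 1 * Real.sin φ := fun φ => by ring
  simp only [this]
  ring

theorem integral_comp_scale {E : Type*} [NormedAddCommGroup E] [NormedSpace ℝ E] (F : Plane → E)
    {L : ℝ} (hL : 0 < L) : ∫ x, F (L • x) = (L ^ 2)⁻¹ • ∫ x, F x := by
  rw [Measure.integral_comp_smul]
  simp [abs_of_pos hL]

theorem integrable_invFourier_lowPass {W : ℝ → ℝ} {L : ℝ} (hL : 0 < L)
    (h : Integrable (invFourier (lowPass W 1)) volume) :
    Integrable (invFourier (lowPass W L)) volume := by
  have : invFourier (lowPass W L) = fun t => ((L ^ 2 : ℝ) : ℂ) * invFourier (lowPass W 1) (L * t) :=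
    funext (invFourier_lowPass_scale W hL)
  rw [this]
  exact (h.comp_mul_left' hL.ne').const_mul _

theorem integral_norm_invFourier_lowPass (W : ℝ → ℝ) {L : ℝ} (hL : 0 < L) :
    ∫ t, ‖invFourier (lowPass W L) t‖ = L * ∫ t, ‖invFourier (lowPass W 1) t‖ := by
  simp only [invFourier_lowPass_scale W hL, norm_mul, Complex.norm_real, norm_pow,
    Real.norm_eq_abs, abs_of_pos hL]
  rw [integral_const_mul, Measure.integral_comp_mul_left (fun t => ‖invFourier (lowPass W 1) t‖) L,
    abs_of_pos (inv_pos.2 hL), smul_eq_mul]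
  field_simp

theorem integrable_convKernel {W : ℝ → ℝ} {L : ℝ} (hL : 0 < L)
    (h : Integrable (convKernel W 1) volume) : Integrable (convKernel W L) volume := by
  rw [show convKernel W L = fun x => ((L ^ 2 : ℝ) : ℂ) * convKernel W 1 (L • x) from
    funext (convKernel_scale W hL)]
  exact (h.comp_smul hL.ne').const_mul _

theorem integral_convKernel_scale (W : ℝ → ℝ) {L : ℝ} (hL : 0 < L) :
    ∫ x, convKernel W L x = ∫ x, convKernel W 1 x := by
  simp only [convKernel_scale W hL]
  rw [integral_const_mul, integral_comp_scale _ hL, Complex.real_smul, ← mul_assoc,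
    ← Complex.ofReal_mul, mul_inv_cancel₀ (by positivity)]
  simp

theorem integral_monomial_convKernel_scale {W : ℝ → ℝ} {L : ℝ} (hL : 0 < L) {j₁ j₂ : ℕ}
    (h : ∫ x : Plane, (x 0 ^ j₁ * x 1 ^ j₂) • convKernel W 1 x = 0) :
    ∫ x : Plane, (x 0 ^ j₁ * x 1 ^ j₂) • convKernel W L x = 0 := by
  have e : (fun x : Plane => (x 0 ^ j₁ * x 1 ^ j₂) • convKernel W L x) = fun x : Plane =>
      (L ^ 2 / L ^ (j₁ + j₂)) • (fun y : Plane => (y 0 ^ j₁ * y 1 ^ j₂) • convKernel W 1 y)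
        (L • x) := by
    funext x
    rw [convKernel_scale W hL, ← Complex.real_smul]
    simp only [smul_smul, PiLp.smul_apply, smul_eq_mul]
    congr 1
    rw [mul_pow, mul_pow, pow_add]
    field_simp
  rw [e, integral_smul, integral_comp_scale
    (fun y : Plane => (y 0 ^ j₁ * y 1 ^ j₂) • convKernel W 1 y) hL, h]
  simp

/-- The factor `L²` is absorbed by the change of variables `x ↦ L x`, so the `α`-th absolute moment
scales like `L^(-α)`: this is the rate of the approximation error. -/
theorem rpow_norm_mul_convKernel (W : ℝ → ℝ) {L : ℝ} (hL : 0 < L) (α : ℝ) (x : Plane) :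
    ‖x‖ ^ α * ‖convKernel W L x‖ =
      L ^ 2 * L ^ (-α) * (‖L • x‖ ^ α * ‖convKernel W 1 (L • x)‖) := by
  rw [convKernel_scale W hL, norm_mul, Complex.norm_real, norm_smul, Real.norm_eq_abs,
    Real.norm_eq_abs, abs_of_pos hL, abs_of_pos (by positivity), Real.mul_rpow hL.le
    (norm_nonneg _), Real.rpow_neg hL.le]
  have : 0 < L ^ α := by positivity
  field_simp

theorem integrable_rpow_norm_mul_convKernel {W : ℝ → ℝ} {L : ℝ} (hL : 0 < L) {α : ℝ}
    (h : Integrable (fun x : Plane => ‖x‖ ^ α * ‖convKernel W 1 x‖) volume) :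
    Integrable (fun x : Plane => ‖x‖ ^ α * ‖convKernel W L x‖) volume := by
  simp only [rpow_norm_mul_convKernel W hL α]
  exact (h.comp_smul hL.ne').const_mul _

theorem integral_rpow_norm_mul_convKernel (W : ℝ → ℝ) {L : ℝ} (hL : 0 < L) (α : ℝ) :
    ∫ x : Plane, ‖x‖ ^ α * ‖convKernel W L x‖ =
      L ^ (-α) * ∫ x : Plane, ‖x‖ ^ α * ‖convKernel W 1 x‖ := by
  simp only [rpow_norm_mul_convKernel W hL α]
  rw [integral_const_mul, integral_comp_scale (fun x => ‖x‖ ^ α * ‖convKernel W 1 x‖) hL,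
    smul_eq_mul]
  field_simp

end Scaling

/-! ### The kernel has total mass one -/

section KernelMass

open scoped FourierTransform RealInnerProductSpace

/-- The contribution of the positive frequencies to the inverse Fourier transform of the filter. -/
noncomputable def halfFourier (W : ℝ → ℝ) (τ : ℝ) : ℂ :=
  ∫ r in Set.Ioi (0 : ℝ), (lowPass W 1 r : ℂ) * Complex.exp (Complex.I * r * τ)

theorem norm_exp_I_mul (a b : ℝ) : ‖Complex.exp (Complex.I * a * b)‖ = 1 := by
  rw [show Complex.I * (a : ℂ) * b = ((a * b : ℝ) : ℂ) * Complex.I by push_cast; ring]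
  exact Complex.norm_exp_ofReal_mul_I _

theorem integrable_mul_exp {A : ℝ → ℝ} (hA : Integrable A volume) (τ : ℝ) :
    Integrable (fun S : ℝ => (A S : ℂ) * Complex.exp (Complex.I * S * τ)) volume := by
  refine hA.ofReal.mul_bdd (c := 1) ?_ (ae_of_all _ fun S => (norm_exp_I_mul S τ).le)
  exact Continuous.aestronglyMeasurable (by fun_prop)

theorem continuous_integral_mul_exp {A : ℝ → ℝ} {s : Set ℝ} (hA : Integrable A (volume.restrict s)) :
    Continuous fun τ : ℝ => ∫ S in s, (A S : ℂ) * Complex.exp (Complex.I * S * τ) := by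
  refine continuous_of_dominated (bound := fun S => ‖A S‖) (fun τ => ?_)
    (fun τ => ae_of_all _ fun S => ?_) hA.norm (ae_of_all _ fun S => by fun_prop)
  · exact hA.ofReal.aestronglyMeasurable.mul (Continuous.aestronglyMeasurable (by fun_prop))
  · rw [norm_mul, norm_exp_I_mul, mul_one, Complex.norm_real]

theorem integral_lowPass_mul_exp {W : ℝ → ℝ} (hWeven : Function.Even W)
    (hA : Integrable (lowPass W 1) volume) (τ : ℝ) :
    ∫ S : ℝ, (lowPass W 1 S : ℂ) * Complex.exp (Complex.I * S * τ) =
      halfFourier W τ + halfFourier W (-τ) := by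
  have hi := integrable_mul_exp hA τ
  rw [← intervalIntegral.integral_Iic_add_Ioi (b := 0) hi.integrableOn hi.integrableOn,
    add_comm]
  congr 1
  have h := integral_comp_neg_Ioi (0 : ℝ)
    (fun S : ℝ => (lowPass W 1 S : ℂ) * Complex.exp (Complex.I * S * τ))
  rw [neg_zero] at h
  rw [← h, halfFourier]
  congr 1; funext S
  have : lowPass W 1 (-S) = lowPass W 1 S := by
    simp only [lowPass, div_one, abs_neg, hWeven S]
  rw [this]
  push_cast
  ring_nf

/-- Negative frequencies at angle `φ` are positive frequencies at angle `φ - π`, so back projection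
over half a turn becomes an integral over the full circle. The constant is `1/2 · 1/π · 1/(2π)`. -/
theorem convKernel_eq_integral_halfFourier {W : ℝ → ℝ} (hWeven : Function.Even W)
    (hA : Integrable (lowPass W 1) volume) (x : Plane) :
    convKernel W 1 x = ((1 / (4 * Real.pi ^ 2) : ℝ) : ℂ) * ∫ φ in (-Real.pi)..Real.pi,
      halfFourier W (x 0 * Real.cos φ + x 1 * Real.sin φ) := by
  have hc : Continuous (halfFourier W) := continuous_integral_mul_exp hA.restrict
  have hci : ∀ a b : ℝ, IntervalIntegrable
      (fun φ : ℝ => halfFourier W (x 0 * Real.cos φ + x 1 * Real.sin φ)) volume a b := fun a b =>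
    Continuous.intervalIntegrable (by fun_prop) _ _
  have hneg : ∫ φ in (0 : ℝ)..Real.pi, halfFourier W (-(x 0 * Real.cos φ + x 1 * Real.sin φ)) =
      ∫ φ in (-Real.pi)..0, halfFourier W (x 0 * Real.cos φ + x 1 * Real.sin φ) := by
    have h := intervalIntegral.integral_comp_sub_right (a := 0) (b := Real.pi)
      (fun φ : ℝ => halfFourier W (x 0 * Real.cos φ + x 1 * Real.sin φ)) Real.pi
    rw [zero_sub, sub_self] at h
    rw [← h]
    congr 1; funext φ
    rw [Real.cos_sub_pi, Real.sin_sub_pi]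
    congr 1; ring
  simp only [convKernel, backProj, invFourier, integral_lowPass_mul_exp hWeven hA]
  rw [intervalIntegral.integral_smul, intervalIntegral.integral_add (hci _ _)
    (Continuous.intervalIntegrable (by fun_prop) _ _), hneg, add_comm,
    intervalIntegral.integral_add_adjacent_intervals (hci _ _) (hci _ _)]
  simp only [Complex.real_smul]
  push_cast
  field_simp
  ring

/-- Polar coordinates: the Jacobian `r` turns `W r` into the filter `|r| W r`. -/
theorem integral_radial_mul_exp {W : ℝ → ℝ} (hA : Integrable (lowPass W 1) volume) (x : Plane) :
    ∫ ξ : Plane, (W ‖ξ‖ : ℂ) * Complex.exp (Complex.I * ⟪ξ, x⟫) =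
      ∫ φ in (-Real.pi)..Real.pi, halfFourier W (x 0 * Real.cos φ + x 1 * Real.sin φ) := by
  -- Rotation by the angle `0` serves as the identification of `ℝ × ℝ` with the plane.
  rw [← (measurePreserving_rotEquiv 0).integral_comp (rotEquiv 0).measurableEmbedding,
    ← integral_comp_polarCoord_symm, polarCoord_target,
    intervalIntegral.integral_of_le (by linarith [Real.pi_pos]), ← restrict_Ioo_eq_restrict_Ioc]
  have e : ∀ z ∈ Set.Ioi (0 : ℝ) ×ˢ Set.Ioo (-Real.pi) Real.pi,
      z.1 • ((W ‖rotEquiv 0 (polarCoord.symm z)‖ : ℂ) *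
        Complex.exp (Complex.I * ⟪rotEquiv 0 (polarCoord.symm z), x⟫)) =
      (lowPass W 1 z.1 : ℂ) * Complex.exp (Complex.I * z.1 *
        ((x 0 * Real.cos z.2 + x 1 * Real.sin z.2 : ℝ) : ℂ)) := by
    intro z hz
    have hz1 : 0 < z.1 := hz.1
    have hn : ‖rotEquiv 0 (polarCoord.symm z)‖ = z.1 := by
      rw [EuclideanSpace.norm_eq, Fin.sum_univ_two, rotEquiv_apply, polarCoord_symm_apply]
      simp only [Real.norm_eq_abs, sq_abs]
      conv_rhs => rw [← Real.sqrt_sq hz1.le]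
      congr 1
      simp
      linear_combination z.1 ^ 2 * Real.sin_sq_add_cos_sq z.2
    have hin : ⟪rotEquiv 0 (polarCoord.symm z), x⟫ =
        z.1 * (x 0 * Real.cos z.2 + x 1 * Real.sin z.2) := by
      rw [rotEquiv_apply, polarCoord_symm_apply, PiLp.inner_apply, Fin.sum_univ_two]
      simp
      ring
    rw [hn, hin, lowPass, abs_of_pos hz1, div_one, Complex.real_smul]
    push_cast
    ring_nf
  rw [setIntegral_congr_fun (measurableSet_Ioi.prod measurableSet_Ioo) e, Measure.volume_eq_prod,
    ← Measure.prod_restrict, integral_prod_symm]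
  · rfl
  · have h1 : Integrable (fun z : ℝ × ℝ => ((lowPass W 1 z.1 : ℝ) : ℂ))
        ((volume.restrict (Set.Ioi 0)).prod (volume.restrict (Set.Ioo (-Real.pi) Real.pi))) :=
      (hA.restrict.ofReal (𝕜 := ℂ)).comp_fst _
    refine h1.mul_bdd (c := 1) ?_ (ae_of_all _ fun z => (norm_exp_I_mul _ _).le)
    exact Continuous.aestronglyMeasurable (by fun_prop)

theorem integrable_radial {W : ℝ → ℝ} (hA : Integrable (lowPass W 1) volume) :
    Integrable (fun ξ : Plane => (W ‖ξ‖ : ℂ)) volume := by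
  refine Integrable.ofReal (f := fun ξ : Plane => W ‖ξ‖)
    ((integrable_fun_norm_addHaar (volume : Measure Plane)).2 ?_)
  refine (hA.integrableOn (s := Set.Ioi 0)).congr_fun (fun r hr => ?_) measurableSet_Ioi
  have hr' : 0 < r := hr
  simp [lowPass, abs_of_pos hr']

/-- The dilation by `-2π` translates between the exponentials `e^(-2πi⟨ξ,x⟩)` and `e^(i⟨ξ,x⟩)`. -/
theorem convKernel_eq_fourier {W : ℝ → ℝ} (hWeven : Function.Even W)
    (hA : Integrable (lowPass W 1) volume) (x : Plane) :
    𝓕 (fun ξ : Plane => (W ‖ξ‖ : ℂ)) x =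
      ((4 * Real.pi ^ 2 : ℝ) : ℂ) * convKernel W 1 ((-(2 * Real.pi)) • x) := by
  rw [convKernel_eq_integral_halfFourier hWeven hA, ← integral_radial_mul_exp hA, ← mul_assoc,
    ← Complex.ofReal_mul, mul_one_div_cancel (by positivity), Complex.ofReal_one, one_mul,
    Real.fourier_eq']
  congr 1; funext ξ
  rw [smul_eq_mul, mul_comm, inner_smul_right]
  congr 2
  push_cast
  ring

/-- Fourier inversion for `ξ ↦ W ‖ξ‖` at the origin, where it is continuous: the integral of its
transform equals `W 0 = 1`. -/
theorem integral_convKernel {W : ℝ → ℝ} (hWeven : Function.Even W)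
    (hW0 : W 0 = 1) (hWc : ContinuousAt W 0) (hA : Integrable (lowPass W 1) volume)
    (hK : Integrable (convKernel W 1) volume) : ∫ x, convKernel W 1 x = 1 := by
  have h2π : -(2 * Real.pi) ≠ 0 := by
    have := Real.pi_pos
    exact neg_ne_zero.2 (by positivity)
  have hF : 𝓕 (fun ξ : Plane => (W ‖ξ‖ : ℂ)) =
      fun x => ((4 * Real.pi ^ 2 : ℝ) : ℂ) * convKernel W 1 ((-(2 * Real.pi)) • x) :=
    funext (convKernel_eq_fourier hWeven hA)
  have hFi : Integrable (𝓕 (fun ξ : Plane => (W ‖ξ‖ : ℂ))) volume := by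
    rw [hF]
    exact (hK.comp_smul h2π).const_mul _
  have hcont : ContinuousAt (fun ξ : Plane => (W ‖ξ‖ : ℂ)) 0 := by
    refine Complex.continuous_ofReal.continuousAt.comp (ContinuousAt.comp (g := W) ?_
      continuous_norm.continuousAt)
    rwa [norm_zero]
  have h := (integrable_radial hA).fourierInv_fourier_eq hFi hcont
  rw [Real.fourierInv_eq', hF] at h
  simp only [inner_zero_right, mul_zero, Complex.ofReal_zero, zero_mul, Complex.exp_zero,
    one_smul, norm_zero, hW0, Complex.ofReal_one] at h
  rw [integral_const_mul, Measure.integral_comp_smul, Complex.real_smul, ← mul_assoc,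
    ← Complex.ofReal_mul] at h
  -- In dimension two the dilation by `-2π` contributes `(2π)^(-2)`, cancelling the normalization.
  have hc : 4 * Real.pi ^ 2 * |((-(2 * Real.pi)) ^ Module.finrank ℝ Plane)⁻¹| = 1 := by
    rw [finrank_euclideanSpace_fin, neg_sq, abs_of_pos (by positivity)]
    field_simp
    norm_num
  rwa [hc, Complex.ofReal_one, one_mul] at h

end KernelMass

/-! ### Reconstruction from exact data -/

section NoiseFree

theorem continuous_invFourier_lowPass {W : ℝ → ℝ} (hA : Integrable (lowPass W 1) volume) {L : ℝ}
    (hL : 0 < L) : Continuous (invFourier (lowPass W L)) := by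
  have h1 : Continuous (invFourier (lowPass W 1)) := by
    have h := continuous_integral_mul_exp (s := Set.univ) hA.restrict
    simp only [Measure.restrict_univ] at h
    exact h.const_smul (1 / (2 * Real.pi) : ℝ)
  rw [show invFourier (lowPass W L) = fun t => ((L ^ 2 : ℝ) : ℂ) * invFourier (lowPass W 1) (L * t)
    from funext (invFourier_lowPass_scale W hL)]
  fun_prop

theorem exists_norm_invFourier_le (A : ℝ → ℝ) : ∃ C, ∀ t, ‖invFourier A t‖ ≤ C := by
  refine ⟨‖(1 / (2 * Real.pi) : ℝ)‖ * ∫ S, ‖A S‖, fun t => ?_⟩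
  rw [invFourier, norm_smul]
  refine mul_le_mul_of_nonneg_left ?_ (norm_nonneg _)
  refine (norm_integral_le_integral_norm _).trans (le_of_eq ?_)
  congr 1; funext S
  rw [norm_mul, norm_exp_I_mul, mul_one, Complex.norm_real]

variable {f : Plane → ℝ} {a : ℝ → ℂ} {C : ℝ}

theorem integrable_comp_rotEquiv (hf : Integrable f volume) (φ : ℝ) :
    Integrable (fun z : ℝ × ℝ => f (rotEquiv φ z)) (volume.prod volume) :=
  ((measurePreserving_rotEquiv φ).integrable_comp_emb (rotEquiv φ).measurableEmbedding).2 hf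

theorem integrable_mul_radon (hf : Integrable f volume) (ha : Continuous a)
    (haC : ∀ t, ‖a t‖ ≤ C) (t φ : ℝ) :
    Integrable (fun s => a s * (radon f (t - s, φ) : ℂ)) volume := by
  have h : Integrable (fun s => radon f (s, φ)) volume :=
    (integrable_comp_rotEquiv hf φ).integral_prod_left
  exact (h.comp_sub_left t).ofReal.bdd_mul ha.aestronglyMeasurable (ae_of_all _ haC)

/-- Fubini in coordinates rotated by `φ`: filtering the projection at angle `φ` amounts to
integrating `f` against a function constant along the lines of that direction. -/
theorem integral_mul_radon (hf : Integrable f volume) (ha : Continuous a)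
    (haC : ∀ t, ‖a t‖ ≤ C) (t φ : ℝ) :
    ∫ s, a s * (radon f (t - s, φ) : ℂ) =
      ∫ y : Plane, a (t - (y 0 * Real.cos φ + y 1 * Real.sin φ)) * (f y : ℂ) := by
  have h1 := integral_sub_left_eq_self (fun s => a s * (radon f (t - s, φ) : ℂ)) volume t
  simp only [sub_sub_cancel] at h1
  rw [← h1, ← (measurePreserving_rotEquiv φ).integral_comp (rotEquiv φ).measurableEmbedding]
  have h2 : ∀ z : ℝ × ℝ, rotEquiv φ z 0 * Real.cos φ + rotEquiv φ z 1 * Real.sin φ = z.1 :=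
    fun z => congrArg Prod.fst ((rotEquiv φ).symm_apply_apply z)
  simp only [h2]
  rw [Measure.volume_eq_prod, integral_prod]
  · congr 1; funext s
    dsimp only
    rw [integral_const_mul, integral_complex_ofReal]
    rfl
  · refine (integrable_comp_rotEquiv hf φ).ofReal.bdd_mul (c := C) ?_ (ae_of_all _ fun z => haC _)
    exact Continuous.aestronglyMeasurable (by fun_prop)

theorem integrable_prod_mul_backProj (hf : Integrable f volume) (ha : Continuous a)
    (haC : ∀ t, ‖a t‖ ≤ C) (x : Plane) :
    Integrable (fun z : ℝ × Plane => a (x 0 * Real.cos z.1 + x 1 * Real.sin z.1 -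
      (z.2 0 * Real.cos z.1 + z.2 1 * Real.sin z.1)) * (f z.2 : ℂ))
      ((volume.restrict (Set.Ioc 0 Real.pi)).prod volume) := by
  refine Integrable.bdd_mul (c := C) (g := fun z : ℝ × Plane => (f z.2 : ℂ))
    ((hf.ofReal (𝕜 := ℂ)).comp_snd _) ?_ (ae_of_all _ fun z => haC _)
  exact Continuous.aestronglyMeasurable (by fun_prop)

theorem intervalIntegrable_filtered_radon {W : ℝ → ℝ} {L : ℝ} (hf : Integrable f volume)
    (ha : Continuous (invFourier (lowPass W L)))
    (x : Plane) : IntervalIntegrable (fun φ => filtered W L (radon f)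
      (x 0 * Real.cos φ + x 1 * Real.sin φ, φ)) volume 0 Real.pi := by
  obtain ⟨C, haC⟩ := exists_norm_invFourier_le (lowPass W L)
  rw [intervalIntegrable_iff_integrableOn_Ioc_of_le Real.pi_pos.le]
  simp only [filtered, integral_mul_radon hf ha haC]
  exact (integrable_prod_mul_backProj hf ha haC x).integral_prod_left

/-- Filtered back projection of exact data is convolution with the kernel. -/
theorem reconstruction_radon {W : ℝ → ℝ} {L : ℝ} (hf : Integrable f volume)
    (ha : Continuous (invFourier (lowPass W L))) (x : Plane) :
    reconstruction W L (radon f) x = ∫ y, convKernel W L y * (f (x - y) : ℂ) := by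
  obtain ⟨C, haC⟩ := exists_norm_invFourier_le (lowPass W L)
  have h1 := integral_sub_left_eq_self (fun y => convKernel W L y * (f (x - y) : ℂ)) volume x
  simp only [sub_sub_cancel] at h1
  rw [← h1]
  simp only [reconstruction, backProj, filtered, integral_mul_radon hf ha haC]
  rw [intervalIntegral.integral_of_le Real.pi_pos.le,
    integral_integral_swap (integrable_prod_mul_backProj hf ha haC x), ← integral_smul,
    ← integral_smul]
  congr 1; funext y
  rw [convKernel, backProj, integral_mul_const, intervalIntegral.integral_of_le Real.pi_pos.le,
    smul_mul_assoc, smul_mul_assoc]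
  simp only [PiLp.sub_apply]
  congr 4
  funext φ
  congr 1; ring

end NoiseFree

/-! ### Measurability of filtered and back-projected data -/

section Measurability

/-- Lebesgue measure on the angles `[0, π)`. -/
noncomputable def angleMeasure : Measure ℝ := volume.restrict (Set.Ico 0 Real.pi)

instance : IsFiniteMeasure angleMeasure := by
  unfold angleMeasure; infer_instance

theorem angleMeasure_univ : angleMeasure Set.univ = ENNReal.ofReal Real.pi := by
  simp [angleMeasure]

theorem sinoMeasure_eq_prod : sinoMeasure = (volume : Measure ℝ).prod angleMeasure := by
  rw [sinoMeasure, angleMeasure, Measure.volume_eq_prod, ← Measure.prod_restrict,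
    Measure.restrict_univ]

instance : SFinite sinoMeasure := by
  rw [sinoMeasure_eq_prod]; infer_instance

/-- The point `(x cos φ + y sin φ, φ)` of the sinogram seen from the plane. -/
noncomputable def sinoPoint (z : Plane × ℝ) : ℝ × ℝ :=
  (z.1 0 * Real.cos z.2 + z.1 1 * Real.sin z.2, z.2)

theorem continuous_sinoPoint : Continuous sinoPoint := by
  unfold sinoPoint; fun_prop

/-- Rotating the plane by an angle depending on `φ` is a measure-preserving skew product; forgetting
one coordinate then still pulls null sets back to null sets. Almost-everywhere properties of
sinogram data thus survive back projection. -/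
theorem quasiMeasurePreserving_sinoPoint :
    Measure.QuasiMeasurePreserving sinoPoint (volume.prod angleMeasure) sinoMeasure := by
  have h1 : MeasurePreserving (fun z : ℝ × Plane => (id z.1, (rotEquiv z.1).symm z.2))
      (angleMeasure.prod volume) (angleMeasure.prod volume) := by
    refine (MeasurePreserving.id angleMeasure).skew_product
      (g := fun φ x => (rotEquiv φ).symm x) ?_
      (ae_of_all _ fun φ => ((measurePreserving_rotEquiv φ).symm _).map_eq)
    refine Continuous.measurable ?_
    simp only [Function.uncurry_def, rotEquiv_symm_apply]
    fun_prop
  have h2 : Measure.QuasiMeasurePreserving (Prod.map id Prod.fst : ℝ × (ℝ × ℝ) → ℝ × ℝ)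
      (angleMeasure.prod (volume.prod volume)) (angleMeasure.prod volume) :=
    QuasiMeasurePreserving.prodMap (Measure.QuasiMeasurePreserving.id _)
      Measure.quasiMeasurePreserving_fst
  rw [sinoMeasure_eq_prod]
  exact Measure.measurePreserving_swap.quasiMeasurePreserving.comp (h2.comp
    (h1.quasiMeasurePreserving.comp Measure.measurePreserving_swap.quasiMeasurePreserving))

theorem quasiMeasurePreserving_sinoShift :
    Measure.QuasiMeasurePreserving (fun z : (ℝ × ℝ) × ℝ => (z.1.1 - z.2, z.1.2))
      (sinoMeasure.prod volume) sinoMeasure := by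
  refine QuasiMeasurePreserving.prod_of_left (by fun_prop) (ae_of_all _ fun s => ?_)
  rw [sinoMeasure_eq_prod]
  exact ((measurePreserving_sub_right volume s).prod
    (MeasurePreserving.id angleMeasure)).quasiMeasurePreserving

theorem aestronglyMeasurable_radon {f : Plane → ℝ} (hf : AEStronglyMeasurable f volume) :
    AEStronglyMeasurable (radon f) sinoMeasure := by
  have h1 : Measure.QuasiMeasurePreserving (fun z : ℝ × (ℝ × ℝ) => rotEquiv z.1 z.2)
      (angleMeasure.prod (volume.prod volume)) volume := by
    refine QuasiMeasurePreserving.prod_of_right ?_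
      (ae_of_all _ fun φ => (measurePreserving_rotEquiv φ).quasiMeasurePreserving)
    refine Continuous.measurable ?_
    simp only [rotEquiv_apply]
    fun_prop
  have h2 : MeasurePreserving (fun z : (ℝ × ℝ) × ℝ => (z.1.2, (z.1.1, z.2)))
      ((volume.prod angleMeasure).prod volume) (angleMeasure.prod (volume.prod volume)) :=
    (measurePreserving_prodAssoc angleMeasure volume volume).comp
      (Measure.measurePreserving_swap.prod (MeasurePreserving.id volume))
  have h3 := hf.comp_quasiMeasurePreserving (h1.comp h2.quasiMeasurePreserving)
  rw [sinoMeasure_eq_prod]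
  exact h3.integral_prod_right'

theorem aestronglyMeasurable_filtered_integrand {a : ℝ → ℂ} (ha : Continuous a) {g : ℝ × ℝ → ℝ}
    (hg : AEStronglyMeasurable g sinoMeasure) :
    AEStronglyMeasurable (fun z : (ℝ × ℝ) × ℝ => a z.2 * (g (z.1.1 - z.2, z.1.2) : ℂ))
      (sinoMeasure.prod volume) :=
  (ha.comp continuous_snd).aestronglyMeasurable.mul
    (Complex.continuous_ofReal.comp_aestronglyMeasurable
      (hg.comp_quasiMeasurePreserving quasiMeasurePreserving_sinoShift))

theorem aestronglyMeasurable_filtered_sinoPoint {W : ℝ → ℝ} {L : ℝ}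
    (ha : Continuous (invFourier (lowPass W L))) {g : ℝ × ℝ → ℝ}
    (hg : AEStronglyMeasurable g sinoMeasure) :
    AEStronglyMeasurable (fun z => filtered W L g (sinoPoint z)) (volume.prod angleMeasure) :=
  (aestronglyMeasurable_filtered_integrand ha
    hg).integral_prod_right'.comp_quasiMeasurePreserving quasiMeasurePreserving_sinoPoint

theorem backProj_eq (h : ℝ × ℝ → ℂ) (x : Plane) :
    backProj h x = (1 / Real.pi : ℝ) • ∫ φ, h (sinoPoint (x, φ)) ∂angleMeasure := by
  rw [backProj, intervalIntegral.integral_of_le Real.pi_pos.le, angleMeasure,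
    integral_Ico_eq_integral_Ioc]
  rfl

theorem aestronglyMeasurable_reconstruction {W : ℝ → ℝ} {L : ℝ}
    (ha : Continuous (invFourier (lowPass W L))) {g : ℝ × ℝ → ℝ}
    (hg : AEStronglyMeasurable g sinoMeasure) :
    AEStronglyMeasurable (reconstruction W L g) volume := by
  unfold reconstruction
  simp only [backProj_eq]
  exact ((aestronglyMeasurable_filtered_sinoPoint ha
    hg).integral_prod_right'.const_smul (1 / Real.pi : ℝ)).const_smul (1 / 2 : ℝ)

end Measurability

/-! ### Propagation of the data error -/

section DataError

theorem lintegral_rpow_le {Y : Type*} [MeasurableSpace Y] {ν : Measure Y} {h : Y → ℝ≥0∞}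
    (hh : AEMeasurable h ν) {r : ℝ} (hr : 1 ≤ r) :
    (∫⁻ y, h y ∂ν) ^ r ≤ ν Set.univ ^ (r - 1) * ∫⁻ y, h y ^ r ∂ν := by
  have hr0 : 0 < r := by linarith
  have h1 := eLpNorm'_le_eLpNorm'_mul_rpow_measure_univ zero_lt_one hr hh.aestronglyMeasurable
  simp only [eLpNorm', enorm_eq_self, ENNReal.rpow_one, div_one] at h1
  have h2 := ENNReal.rpow_le_rpow h1 hr0.le
  rw [ENNReal.mul_rpow_of_nonneg _ _ hr0.le, ← ENNReal.rpow_mul, ← ENNReal.rpow_mul,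
    one_div_mul_cancel hr0.ne', ENNReal.rpow_one, sub_mul, one_div_mul_cancel hr0.ne', one_mul,
    mul_comm] at h2
  exact h2

/-- A line meets a bounded set in a set of length at most the diameter. -/
theorem volume_slice_le {Ω : Set Plane} (hΩ : Bornology.IsBounded Ω) (φ t : ℝ) :
    volume {s : ℝ | rotEquiv φ (t, s) ∈ Ω} ≤ ENNReal.ofReal (Metric.diam Ω) := by
  refine (Real.volume_le_diam _).trans (Metric.ediam_le_of_forall_dist_le fun s hs s' hs' => ?_)
  rw [← dist_rotEquiv φ t]
  exact Metric.dist_le_diam_of_mem hΩ hs hs'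

/-- In rotated coordinates the integrand depends on `t` alone, and each slice of `Ω` has length at
most the diameter. -/
theorem setLIntegral_ridge_le {Ω : Set Plane} (hΩ : IsCompact Ω) {Q : ℝ → ℝ≥0∞}
    (hQ : Measurable Q) (φ : ℝ) :
    ∫⁻ x in Ω, Q (x 0 * Real.cos φ + x 1 * Real.sin φ) ≤
      ENNReal.ofReal (Metric.diam Ω) * ∫⁻ t, Q t := by
  have h2 : ∀ z : ℝ × ℝ, rotEquiv φ z 0 * Real.cos φ + rotEquiv φ z 1 * Real.sin φ = z.1 :=
    fun z => congrArg Prod.fst ((rotEquiv φ).symm_apply_apply z)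
  have hS : MeasurableSet (rotEquiv φ ⁻¹' Ω) := (rotEquiv φ).measurable hΩ.measurableSet
  rw [← (measurePreserving_rotEquiv φ).setLIntegral_comp_preimage_emb
    (rotEquiv φ).measurableEmbedding]
  simp only [h2]
  have hm : Measurable ((rotEquiv φ ⁻¹' Ω).indicator fun z : ℝ × ℝ => Q z.1) :=
    (hQ.comp measurable_fst).indicator hS
  rw [← lintegral_indicator hS, Measure.volume_eq_prod, lintegral_prod _ hm.aemeasurable, mul_comm,
    ← lintegral_mul_const _ hQ]
  refine lintegral_mono fun t => ?_
  have hSt : MeasurableSet {s : ℝ | rotEquiv φ (t, s) ∈ Ω} := measurable_prodMk_left hS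
  calc ∫⁻ s, (rotEquiv φ ⁻¹' Ω).indicator (fun z => Q z.1) (t, s)
      = ∫⁻ s, {s : ℝ | rotEquiv φ (t, s) ∈ Ω}.indicator (fun _ => Q t) s := rfl
    _ = Q t * volume {s : ℝ | rotEquiv φ (t, s) ∈ Ω} := lintegral_indicator_const hSt _
    _ ≤ _ := by gcongr; exact volume_slice_le hΩ.isBounded φ t

/-- For finite `p = r`, the power mean inequality in the angle costs `π^(r-1)`; after Tonelli each
angle is a ridge integral costing `diam Ω`. Taking `r`-th roots gives the constant. -/
theorem eLpNorm_backProj_le_of_measurable {Ω : Set Plane} (hΩ : IsCompact Ω) {p : ℝ≥0∞}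
    (hp : 1 ≤ p) {H : ℝ × ℝ → ℝ≥0∞} (hH : Measurable H) :
    eLpNorm (fun x => ∫⁻ φ, H (sinoPoint (x, φ)) ∂angleMeasure) p (volume.restrict Ω) ≤
      ENNReal.ofReal (Real.pi ^ (1 - 1 / p.toReal) * Metric.diam Ω ^ (1 / p.toReal)) *
        eLpNorm H p sinoMeasure := by
  have hπ := Real.pi_pos
  rcases eq_or_ne p ∞ with rfl | hpt
  -- With `∞.toReal = 0` and `1 / 0 = 0` the constant is `π`, the length of the angular interval.
  · simp only [ENNReal.toReal_top, div_zero, sub_zero, Real.rpow_one, Real.rpow_zero, mul_one,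
      eLpNorm_exponent_top]
    refine eLpNormEssSup_le_of_ae_enorm_bound ?_
    have h1 : ∀ᵐ z ∂sinoMeasure, H z ≤ eLpNormEssSup H sinoMeasure := by
      simpa using ae_le_eLpNormEssSup (f := H) (μ := sinoMeasure)
    have h2 := Measure.ae_ae_of_ae_prod (quasiMeasurePreserving_sinoPoint.ae h1)
    filter_upwards [ae_restrict_of_ae h2] with x hx
    rw [enorm_eq_self]
    refine (lintegral_mono_ae hx).trans ?_
    rw [lintegral_const, angleMeasure_univ, mul_comm]
  have hp0 : p ≠ 0 := (zero_lt_one.trans_le hp).ne'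
  have hr1 : 1 ≤ p.toReal := by
    simpa using (ENNReal.toReal_le_toReal (by simp) hpt).2 hp
  rw [eLpNorm_eq_lintegral_rpow_enorm_toReal hp0 hpt, eLpNorm_eq_lintegral_rpow_enorm_toReal hp0 hpt]
  simp only [enorm_eq_self]
  set r := p.toReal
  have hr0 : 0 < r := by linarith
  have hm : Measurable fun z : Plane × ℝ => H (sinoPoint z) :=
    hH.comp continuous_sinoPoint.measurable
  have key : ∫⁻ x in Ω, (∫⁻ φ, H (sinoPoint (x, φ)) ∂angleMeasure) ^ r ≤
      ENNReal.ofReal (Real.pi ^ (r - 1) * Metric.diam Ω) * ∫⁻ z, H z ^ r ∂sinoMeasure := by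
    calc ∫⁻ x in Ω, (∫⁻ φ, H (sinoPoint (x, φ)) ∂angleMeasure) ^ r
        ≤ ∫⁻ x in Ω, ENNReal.ofReal Real.pi ^ (r - 1) *
            ∫⁻ φ, H (sinoPoint (x, φ)) ^ r ∂angleMeasure := by
          refine lintegral_mono fun x => ?_
          rw [← angleMeasure_univ]
          exact lintegral_rpow_le (hm.comp measurable_prodMk_left).aemeasurable hr1
      _ = ENNReal.ofReal Real.pi ^ (r - 1) *
            ∫⁻ φ, (∫⁻ x in Ω, H (sinoPoint (x, φ)) ^ r) ∂angleMeasure := by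
          rw [lintegral_const_mul' _ _ (ENNReal.rpow_ne_top_of_nonneg (by linarith)
            ENNReal.ofReal_ne_top), lintegral_lintegral_swap]
          exact (hm.pow_const r).aemeasurable
      _ ≤ ENNReal.ofReal Real.pi ^ (r - 1) *
            ∫⁻ φ, ENNReal.ofReal (Metric.diam Ω) * (∫⁻ t, H (t, φ) ^ r) ∂angleMeasure := by
          gcongr with φ
          exact setLIntegral_ridge_le hΩ (Q := fun t => H (t, φ) ^ r)
            ((hH.comp measurable_prodMk_right).pow_const r) φ
      _ = _ := by
          rw [lintegral_const_mul' _ _ ENNReal.ofReal_ne_top, ← mul_assoc,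
            ENNReal.ofReal_rpow_of_nonneg hπ.le (by linarith),
            ← ENNReal.ofReal_mul (by positivity), sinoMeasure_eq_prod,
            lintegral_prod_symm _ (hH.pow_const r).aemeasurable]
  refine (ENNReal.rpow_le_rpow key (z := 1 / r) (by positivity)).trans (le_of_eq ?_)
  rw [ENNReal.mul_rpow_of_nonneg _ _ (by positivity),
    ENNReal.ofReal_rpow_of_nonneg (mul_nonneg (by positivity) Metric.diam_nonneg) (by positivity),
    Real.mul_rpow (by positivity) Metric.diam_nonneg, ← Real.rpow_mul hπ.le, sub_mul,
    mul_one_div_cancel hr0.ne', one_mul]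

theorem eLpNorm_backProj_le {Ω : Set Plane} (hΩ : IsCompact Ω) {p : ℝ≥0∞}
    (hp : 1 ≤ p) {H : ℝ × ℝ → ℝ≥0∞} (hH : AEMeasurable H sinoMeasure) :
    eLpNorm (fun x => ∫⁻ φ, H (sinoPoint (x, φ)) ∂angleMeasure) p (volume.restrict Ω) ≤
      ENNReal.ofReal (Real.pi ^ (1 - 1 / p.toReal) * Metric.diam Ω ^ (1 / p.toReal)) *
        eLpNorm H p sinoMeasure := by
  rw [eLpNorm_congr_ae hH.ae_eq_mk]
  refine (eLpNorm_congr_ae ?_).trans_le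
    (eLpNorm_backProj_le_of_measurable hΩ hp hH.measurable_mk)
  filter_upwards [ae_restrict_of_ae (Measure.ae_ae_of_ae_prod
    (quasiMeasurePreserving_sinoPoint.ae hH.ae_eq_mk))] with x hx
  exact lintegral_congr_ae hx

/-- The convolution of `|a|` with `|g|` in the first variable. -/
noncomputable def absFiltered (a : ℝ → ℂ) (g : ℝ × ℝ → ℝ) (z : ℝ × ℝ) : ℝ≥0∞ :=
  ∫⁻ s, ‖a s * (g (z.1 - s, z.2) : ℂ)‖ₑ

theorem aemeasurable_absFiltered {a : ℝ → ℂ} (ha : Continuous a) {g : ℝ × ℝ → ℝ}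
    (hg : AEStronglyMeasurable g sinoMeasure) : AEMeasurable (absFiltered a g) sinoMeasure :=
  (aestronglyMeasurable_filtered_integrand ha hg).enorm.lintegral_prod_right'

/-- Young's inequality, from Minkowski and the invariance of the sinogram measure under shifts of
the first variable. -/
theorem eLpNorm_absFiltered_le {a : ℝ → ℂ} (ha : Continuous a) (hai : Integrable a volume)
    {g : ℝ × ℝ → ℝ} (hg : AEStronglyMeasurable g sinoMeasure) {p : ℝ≥0∞} (hp : 1 ≤ p) :
    eLpNorm (absFiltered a g) p sinoMeasure ≤
      ENNReal.ofReal (∫ t, ‖a t‖) * eLpNorm g p sinoMeasure := by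
  refine (eLpNorm_lintegral_le hp (b := fun s => ‖a s‖ₑ * eLpNorm g p sinoMeasure)
    (aestronglyMeasurable_filtered_integrand ha hg).enorm
    (ha.measurable.enorm.mul_const _).aemeasurable (ae_of_all _ fun s => ?_)).trans ?_
  · rw [eLpNorm_enorm]
    change eLpNorm (a s • fun z : ℝ × ℝ => (g (z.1 - s, z.2) : ℂ)) p sinoMeasure ≤ _
    rw [eLpNorm_const_smul]
    gcongr
    have hmp : MeasurePreserving (fun z : ℝ × ℝ => (z.1 - s, z.2)) sinoMeasure sinoMeasure := by
      rw [sinoMeasure_eq_prod]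
      exact (measurePreserving_sub_right volume s).prod (MeasurePreserving.id angleMeasure)
    rw [← eLpNorm_comp_measurePreserving hg hmp]
    exact (eLpNorm_congr_norm_ae (ae_of_all _ fun x => by simp)).le
  · rw [lintegral_mul_const _ ha.measurable.enorm, ofReal_integral_norm_eq_lintegral_enorm hai]

theorem ae_lt_top_of_eLpNorm_lt_top {X : Type*} [MeasurableSpace X] {μ : Measure X}
    {G : X → ℝ≥0∞} (hG : AEMeasurable G μ) {p : ℝ≥0∞} (hp : p ≠ 0) (h : eLpNorm G p μ < ∞) :
    ∀ᵐ x ∂μ, G x < ∞ := by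
  rcases eq_or_ne p ∞ with rfl | hpt
  · rw [eLpNorm_exponent_top] at h
    filter_upwards [ae_le_eLpNormEssSup (f := G) (μ := μ)] with x hx
    exact lt_of_le_of_lt (by simpa using hx) h
  · have h1 := lintegral_rpow_enorm_lt_top_of_eLpNorm_lt_top hp hpt h
    simp only [enorm_eq_self] at h1
    have hr := ENNReal.toReal_pos hp hpt
    filter_upwards [ae_lt_top' (hG.pow_const _) h1.ne] with x hx
    exact (ENNReal.rpow_lt_top_iff_of_pos hr).1 hx

/-- Reconstruction error caused by the error `e` of the data `g = u - e`. -/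
theorem ae_enorm_reconstruction_sub_le {W : ℝ → ℝ} {L : ℝ}
    (ha : Continuous (invFourier (lowPass W L))) {μ : Measure Plane} (hμ : μ ≪ volume)
    {u e : ℝ × ℝ → ℝ} (he : AEStronglyMeasurable e sinoMeasure)
    (hu : ∀ t φ, Integrable (fun s => invFourier (lowPass W L) s * (u (t - s, φ) : ℂ)) volume)
    (hu' : ∀ x, Integrable (fun φ => filtered W L u (sinoPoint (x, φ))) angleMeasure)
    (hfin : ∀ᵐ x ∂μ, ∫⁻ φ, absFiltered (invFourier (lowPass W L)) e (sinoPoint (x, φ))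
      ∂angleMeasure < ∞) :
    ∀ᵐ x ∂μ, ‖reconstruction W L u x - reconstruction W L (fun z => u z - e z) x‖ₑ ≤
      ENNReal.ofReal (1 / (2 * Real.pi)) *
        ∫⁻ φ, absFiltered (invFourier (lowPass W L)) e (sinoPoint (x, φ)) ∂angleMeasure := by
  set a := invFourier (lowPass W L)
  have h1 : ∀ᵐ x ∂μ, ∀ᵐ φ ∂angleMeasure, AEStronglyMeasurable
      (fun s => a s * (e ((sinoPoint (x, φ)).1 - s, (sinoPoint (x, φ)).2) : ℂ)) volume :=
    hμ.ae_le (Measure.ae_ae_of_ae_prod (quasiMeasurePreserving_sinoPoint.ae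
      (aestronglyMeasurable_filtered_integrand ha he).prodMk_left))
  have h2 : ∀ᵐ x ∂μ, AEMeasurable (fun φ => absFiltered a e (sinoPoint (x, φ))) angleMeasure := by
    refine hμ.ae_le ?_
    have := ((aemeasurable_absFiltered ha he).comp_quasiMeasurePreserving
      quasiMeasurePreserving_sinoPoint).aestronglyMeasurable.prodMk_left
    filter_upwards [this] with x hx using hx.aemeasurable
  have h3 : ∀ᵐ x ∂μ, AEStronglyMeasurable
      (fun φ => filtered W L e (sinoPoint (x, φ))) angleMeasure :=
    hμ.ae_le (aestronglyMeasurable_filtered_sinoPoint ha he).prodMk_left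
  filter_upwards [h1, h2, h3, hfin] with x h1 h2 h3 hfin
  have hle : ∀ φ, ‖filtered W L e (sinoPoint (x, φ))‖ₑ ≤ absFiltered a e (sinoPoint (x, φ)) :=
    fun φ => enorm_integral_le_lintegral_enorm _
  have hei : Integrable (fun φ => filtered W L e (sinoPoint (x, φ))) angleMeasure :=
    ⟨h3, (lintegral_mono hle).trans_lt hfin⟩
  -- Bochner integrals split only for integrable functions, so filtering is additive only where its
  -- integrals converge. For the error `e` this holds at almost every angle, because `absFiltered`
  -- is finite there.
  have hsub : ∀ᵐ φ ∂angleMeasure, filtered W L (fun z => u z - e z) (sinoPoint (x, φ)) =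
      filtered W L u (sinoPoint (x, φ)) - filtered W L e (sinoPoint (x, φ)) := by
    filter_upwards [h1, ae_lt_top' h2 hfin.ne] with φ hm hf
    simp only [filtered]
    rw [← integral_sub (hu _ _) ⟨hm, hf⟩]
    congr 1; funext s
    push_cast; ring
  have heq : reconstruction W L u x - reconstruction W L (fun z => u z - e z) x =
      ((1 / 2 : ℝ) * (1 / Real.pi : ℝ)) • ∫ φ, filtered W L e (sinoPoint (x, φ)) ∂angleMeasure := by
    simp only [reconstruction, backProj_eq]
    rw [integral_congr_ae hsub, integral_sub (hu' x) hei, ← smul_sub, ← smul_sub,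
      sub_sub_cancel, smul_smul]
  rw [heq, enorm_smul, Real.enorm_of_nonneg (by have := Real.pi_pos; positivity)]
  gcongr ?_ * ?_
  · apply le_of_eq; congr 1; field_simp
  · exact (enorm_integral_le_lintegral_enorm _).trans (lintegral_mono hle)

end DataError

/-! ### Choice of the bandwidth and the combined estimate -/

section MainEstimate

theorem bandwidth_pos {α N δ : ℝ} (hN : 0 < N) (hδ : 0 < δ) : 0 < bandwidth α N δ := by
  unfold bandwidth; positivity

/-- Together with `bandwidth_mul`, this shows that the bandwidth balances `L^(-α) N` against `L δ`.
-/
theorem bandwidth_rpow_neg_mul {α N δ : ℝ} (hα : 0 < α) (hN : 0 < N) (hδ : 0 < δ) :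
    bandwidth α N δ ^ (-α) * N = N ^ (1 / (α + 1)) * δ ^ (α / (α + 1)) := by
  have h1 : α + 1 ≠ 0 := by positivity
  rw [bandwidth, Real.mul_rpow (by positivity) (by positivity), ← Real.rpow_mul hδ.le,
    ← Real.rpow_mul hN.le, mul_assoc, ← Real.rpow_add_one hN.ne', mul_comm]
  congr 2 <;> field_simp
  ring

theorem bandwidth_mul {α N δ : ℝ} (hα : 0 < α) (hδ : 0 < δ) :
    bandwidth α N δ * δ = N ^ (1 / (α + 1)) * δ ^ (α / (α + 1)) := by
  have h1 : α + 1 ≠ 0 := by positivity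
  rw [bandwidth, mul_right_comm, ← Real.rpow_add_one hδ.ne', mul_comm]
  congr 2
  field_simp
  ring

/-- Here `1 / (2π)` is the normalization of the reconstruction and the next factor is the bound for
back projection. -/
theorem cData_eq (W : ℝ → ℝ) (Ω : Set Plane) (p : ℝ≥0∞) :
    cData W Ω p = 1 / (2 * Real.pi) *
      (Real.pi ^ (1 - 1 / p.toReal) * Metric.diam Ω ^ (1 / p.toReal)) *
        ∫ t : ℝ, ‖invFourier (lowPass W 1) t‖ := by
  have hπ := Real.pi_pos
  rw [cData, Real.rpow_sub hπ, Real.rpow_one]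
  have : 0 < Real.pi ^ (1 / p.toReal) := by positivity
  field_simp

theorem cApprox_nonneg (W : ℝ → ℝ) (n : ℕ) {θ : ℝ} (hθ : 0 < θ) (q : ℝ≥0∞) :
    0 ≤ cApprox W n θ q := by
  have h1 := cFrac_nonneg hθ q
  have hΓ1 : 0 < Real.Gamma (θ + 1) := Real.Gamma_pos_of_pos (by linarith)
  have hΓ2 : 0 < Real.Gamma (n + θ + 1) := Real.Gamma_pos_of_pos (by positivity)
  have : 0 ≤ ∫ x : Plane, ‖x‖ ^ (n + θ) * ‖convKernel W 1 x‖ :=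
    integral_nonneg fun x => by positivity
  unfold cApprox
  positivity

theorem cData_nonneg (W : ℝ → ℝ) (Ω : Set Plane) (p : ℝ≥0∞) : 0 ≤ cData W Ω p := by
  have := Real.pi_pos
  have : 0 ≤ ∫ t : ℝ, ‖invFourier (lowPass W 1) t‖ := integral_nonneg fun x => norm_nonneg _
  have : 0 ≤ Metric.diam Ω := Metric.diam_nonneg
  unfold cData
  positivity

/-- The approximation error of exact data. -/
theorem eLpNorm_sub_reconstruction_radon_le {n : ℕ} {θ : ℝ} (hθ : 0 < θ) {p q : ℝ≥0∞}
    (hp : 1 ≤ p) (hq : 1 ≤ q) {f : Plane → ℝ} (hf : Integrable f volume)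
    (hfB : besovSeminorm n θ p q f ≠ ⊤) {W : ℝ → ℝ} (hWeven : Function.Even W)
    (hW0 : W 0 = 1) (hWc : ContinuousAt W 0) (hA : Integrable (lowPass W 1) volume)
    (hK : Integrable (convKernel W 1) volume)
    (hmom : ∀ j₁ j₂ : ℕ, 1 ≤ j₁ + j₂ → j₁ + j₂ ≤ n →
      ∫ x : Plane, (x 0 ^ j₁ * x 1 ^ j₂) • convKernel W 1 x = 0)
    (hKα : Integrable (fun x : Plane => ‖x‖ ^ (n + θ) * ‖convKernel W 1 x‖) volume)
    {L : ℝ} (hL : 0 < L) :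
    eLpNorm (fun x => (f x : ℂ) - reconstruction W L (radon f) x) p volume ≤
      ENNReal.ofReal (cApprox W n θ q * L ^ (-(n + θ))) * besovSeminorm n θ p q f := by
  simp only [reconstruction_radon hf (continuous_invFourier_lowPass hA hL)]
  refine (eLpNorm_sub_convolution_le hf hθ hp hq hfB (integrable_convKernel hL hK) ?_
    (integrable_rpow_norm_mul_convKernel hL hKα) fun j₁ j₂ h1 h2 =>
      integral_monomial_convKernel_scale hL (hmom j₁ j₂ h1 h2)).trans (le_of_eq ?_)
  · rw [integral_convKernel_scale W hL, integral_convKernel hWeven hW0 hWc hA hK]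
  · rw [integral_rpow_norm_mul_convKernel W hL, cApprox]
    congr 2; ring

/-- The error caused by noise in the data. -/
theorem eLpNorm_reconstruction_radon_sub_le {Ω : Set Plane} (hΩ : IsCompact Ω) {p : ℝ≥0∞}
    (hp : 1 ≤ p) {f : Plane → ℝ} (hf : Integrable f volume) {W : ℝ → ℝ}
    (hA : Integrable (lowPass W 1) volume) (hAinv : Integrable (invFourier (lowPass W 1)) volume)
    {L : ℝ} (hL : 0 < L) {g : ℝ × ℝ → ℝ} (hg : AEStronglyMeasurable g sinoMeasure)
    {δ : ℝ} (hδ : eLpNorm (fun z => radon f z - g z) p sinoMeasure ≤ ENNReal.ofReal δ) :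
    eLpNorm (fun x => reconstruction W L (radon f) x - reconstruction W L g x) p
      (volume.restrict Ω) ≤ ENNReal.ofReal (cData W Ω p * (L * δ)) := by
  have hπ := Real.pi_pos
  have ha := continuous_invFourier_lowPass hA hL
  have hai := integrable_invFourier_lowPass hL hAinv
  obtain ⟨C, haC⟩ := exists_norm_invFourier_le (lowPass W L)
  have he : AEStronglyMeasurable (fun z => radon f z - g z) sinoMeasure :=
    (aestronglyMeasurable_radon hf.aestronglyMeasurable).sub hg
  set e : ℝ × ℝ → ℝ := fun z => radon f z - g z
  set G : Plane → ℝ≥0∞ := fun x =>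
    ∫⁻ φ, absFiltered (invFourier (lowPass W L)) e (sinoPoint (x, φ)) ∂angleMeasure
  have hI : 0 ≤ ∫ t, ‖invFourier (lowPass W L) t‖ := integral_nonneg fun t => norm_nonneg _
  have hd : 0 ≤ Metric.diam Ω := Metric.diam_nonneg
  have hG : eLpNorm G p (volume.restrict Ω) ≤
      ENNReal.ofReal (Real.pi ^ (1 - 1 / p.toReal) * Metric.diam Ω ^ (1 / p.toReal) *
        (∫ t, ‖invFourier (lowPass W L) t‖) * δ) := by
    refine (eLpNorm_backProj_le hΩ hp (aemeasurable_absFiltered ha he)).trans ?_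
    rw [mul_assoc _ _ δ, ENNReal.ofReal_mul (q := _ * δ) (by positivity), ENNReal.ofReal_mul hI]
    refine mul_le_mul_right ?_ _
    exact (eLpNorm_absFiltered_le ha hai he hp).trans (by gcongr)
  have hGm : AEMeasurable G (volume.restrict Ω) :=
    (((aemeasurable_absFiltered ha he).comp_quasiMeasurePreserving
      quasiMeasurePreserving_sinoPoint).lintegral_prod_right').restrict
  have hfin := ae_lt_top_of_eLpNorm_lt_top hGm (zero_lt_one.trans_le hp).ne'
    (hG.trans_lt ENNReal.ofReal_lt_top)
  have hae := ae_enorm_reconstruction_sub_le ha Measure.absolutelyContinuous_restrict he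
    (fun t φ => integrable_mul_radon hf ha haC t φ) (fun x => ?_) hfin
  · have hge : (fun z => radon f z - e z) = g := by
      funext z; simp [e]
    rw [hge] at hae
    calc _ ≤ ENNReal.ofReal (1 / (2 * Real.pi)) * eLpNorm G p (volume.restrict Ω) :=
          eLpNorm_le_nnreal_smul_eLpNorm_of_ae_le_mul' hae p
      _ ≤ _ := by
          refine (mul_le_mul_right hG _).trans (le_of_eq ?_)
          rw [← ENNReal.ofReal_mul (by positivity), integral_norm_invFourier_lowPass W hL, cData_eq]
          congr 1; ring
  · have h := intervalIntegrable_filtered_radon hf ha x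
    rw [intervalIntegrable_iff_integrableOn_Ico_of_le hπ.le] at h
    exact h

theorem memLp_and_eLpNorm_sub_reconstruction_le
    {n : ℕ} {θ α : ℝ} (hθ : 0 < θ) (hα : α = n + θ) {p q : ℝ≥0∞} (hp : 1 ≤ p) (hq : 1 ≤ q)
    {Ω : Set Plane} (hΩ : IsCompact Ω) {f : Plane → ℝ} (hf : Integrable f volume)
    (hfB : besovSeminorm n θ p q f ≠ ⊤) (hf0 : besovSeminorm n θ p q f ≠ 0)
    {W : ℝ → ℝ} (hWeven : Function.Even W)
    (hW0 : W 0 = 1) (hWc : ContinuousAt W 0) (hA : Integrable (lowPass W 1) volume)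
    (hAinv : Integrable (invFourier (lowPass W 1)) volume)
    (hK : Integrable (convKernel W 1) volume)
    (hmom : ∀ j₁ j₂ : ℕ, 1 ≤ j₁ + j₂ → j₁ + j₂ ≤ n →
      ∫ x : Plane, (x 0 ^ j₁ * x 1 ^ j₂) • convKernel W 1 x = 0)
    (hKα : Integrable (fun x : Plane => ‖x‖ ^ α * ‖convKernel W 1 x‖) volume)
    {δ : ℝ} (hδ : 0 < δ) {g : ℝ × ℝ → ℝ} (hg : AEStronglyMeasurable g sinoMeasure)
    (hgδ : eLpNorm (fun z => radon f z - g z) p sinoMeasure ≤ ENNReal.ofReal δ) :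
    MemLp (fun x => (f x : ℂ) -
        reconstruction W (bandwidth α (besovSeminorm n θ p q f).toReal δ) g x) p
        (volume.restrict Ω) ∧
      eLpNorm (fun x => (f x : ℂ) -
        reconstruction W (bandwidth α (besovSeminorm n θ p q f).toReal δ) g x) p
        (volume.restrict Ω) ≤
      ENNReal.ofReal ((cApprox W n θ q + cData W Ω p) *
        (besovSeminorm n θ p q f).toReal ^ (1 / (α + 1)) * δ ^ (α / (α + 1))) := by
  have hα0 : 0 < α := by rw [hα]; positivity
  have hN : 0 < (besovSeminorm n θ p q f).toReal := ENNReal.toReal_pos hf0 hfB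
  set N := (besovSeminorm n θ p q f).toReal with hNdef
  set L := bandwidth α N δ with hLdef
  have hL : 0 < L := bandwidth_pos hN hδ
  have ha := continuous_invFourier_lowPass hA hL
  have hRm := aestronglyMeasurable_radon hf.aestronglyMeasurable
  have hfm : AEStronglyMeasurable (fun x => (f x : ℂ)) volume :=
    Complex.continuous_ofReal.comp_aestronglyMeasurable hf.aestronglyMeasurable
  have hm : AEStronglyMeasurable (fun x => (f x : ℂ) - reconstruction W L g x)
      (volume.restrict Ω) := (hfm.sub (aestronglyMeasurable_reconstruction ha hg)).restrict
  have hm1 : AEStronglyMeasurable (fun x => (f x : ℂ) - reconstruction W L (radon f) x)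
      (volume.restrict Ω) := (hfm.sub (aestronglyMeasurable_reconstruction ha hRm)).restrict
  have hm2 : AEStronglyMeasurable
      (fun x => reconstruction W L (radon f) x - reconstruction W L g x) (volume.restrict Ω) :=
    ((aestronglyMeasurable_reconstruction ha hRm).sub
      (aestronglyMeasurable_reconstruction ha hg)).restrict
  have happ : eLpNorm (fun x => (f x : ℂ) - reconstruction W L (radon f) x) p
      (volume.restrict Ω) ≤
      ENNReal.ofReal (cApprox W n θ q * (N ^ (1 / (α + 1)) * δ ^ (α / (α + 1)))) := by
    -- The approximation error is controlled on the whole plane; only the data error needs the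
    -- restriction to `Ω`.
    refine (eLpNorm_mono_measure _ Measure.restrict_le_self).trans
      ((eLpNorm_sub_reconstruction_radon_le hθ hp hq hf hfB hWeven hW0 hWc hA hK hmom
        (hα ▸ hKα) hL).trans (le_of_eq ?_))
    rw [← ENNReal.ofReal_toReal hfB, ← hNdef, ← ENNReal.ofReal_mul
      (mul_nonneg (cApprox_nonneg W n hθ q) (by positivity)), mul_assoc, ← hα, hLdef,
      bandwidth_rpow_neg_mul hα0 hN hδ]
  have hnoise := eLpNorm_reconstruction_radon_sub_le hΩ hp hf hA hAinv hL hg hgδ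
  rw [hLdef, bandwidth_mul hα0 hδ, ← hLdef] at hnoise
  have hle : eLpNorm (fun x => (f x : ℂ) - reconstruction W L g x) p (volume.restrict Ω) ≤
      ENNReal.ofReal ((cApprox W n θ q + cData W Ω p) * N ^ (1 / (α + 1)) * δ ^ (α / (α + 1))) := by
    have e : (fun x => (f x : ℂ) - reconstruction W L g x) =
        (fun x => (f x : ℂ) - reconstruction W L (radon f) x) +
          fun x => reconstruction W L (radon f) x - reconstruction W L g x := by
      funext x; simp
    rw [e]
    refine (eLpNorm_add_le hm1 hm2 hp).trans ((add_le_add happ hnoise).trans (le_of_eq ?_))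
    rw [← ENNReal.ofReal_add (mul_nonneg (cApprox_nonneg W n hθ q) (by positivity))
      (mul_nonneg (cData_nonneg W Ω p) (by positivity))]
    congr 1; ring
  exact ⟨⟨hm, hle.trans_lt ENNReal.ofReal_lt_top⟩, hle⟩

end MainEstimate

end FBP

/-! ### The convergence rate -/

theorem mainTheorem4
    (n : ℕ) (θ α : ℝ) (hθ0 : 0 < θ) (hθ1 : θ < 1) (hα : α = n + θ)
    (p q : ℝ≥0∞) (hp : 1 ≤ p) (hq : 1 ≤ q)
    (Ω : Set FBP.Plane) (hΩ : IsCompact Ω)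
    (f : FBP.Plane → ℝ) (hf1 : Integrable f volume) (hfB : FBP.MemBesov n θ p q f)
    (hf0 : FBP.besovSeminorm n θ p q f ≠ 0)
    (hsupp : ∀ᵐ x ∂(volume : Measure FBP.Plane), x ∉ Ω → f x = 0)
    (W : ℝ → ℝ) (hW : MemLp W ⊤ volume) (hWeven : Function.Even W)
    (hW0 : W 0 = 1) (hWc : ContinuousAt W 0)
    (hA1 : Integrable (FBP.lowPass W 1) volume) (hA2 : MemLp (FBP.lowPass W 1) 2 volume)
    (hAinv : Integrable (FBP.invFourier (FBP.lowPass W 1)) volume)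
    (hK : Integrable (FBP.convKernel W 1) volume)
    (hmom : ∀ j₁ j₂ : ℕ, 1 ≤ j₁ + j₂ → j₁ + j₂ ≤ n →
      ∫ x : FBP.Plane, (x 0 ^ j₁ * x 1 ^ j₂) • FBP.convKernel W 1 x = 0)
    (hKα : Integrable (fun x : FBP.Plane => ‖x‖ ^ α * ‖FBP.convKernel W 1 x‖) volume) :
    (∀ δ : ℝ, 0 < δ → ∀ g : ℝ × ℝ → ℝ, MemLp g p FBP.sinoMeasure →
      eLpNorm (fun z => FBP.radon f z - g z) p FBP.sinoMeasure ≤ ENNReal.ofReal δ →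
      ∀ L : ℝ, L = FBP.bandwidth α (FBP.besovSeminorm n θ p q f).toReal δ →
        MemLp (fun x => (f x : ℂ) - FBP.reconstruction W L g x) p (volume.restrict Ω) ∧
        eLpNorm (fun x => (f x : ℂ) - FBP.reconstruction W L g x) p (volume.restrict Ω) ≤
          ENNReal.ofReal ((FBP.cApprox W n θ q + FBP.cData W Ω p) *
            (FBP.besovSeminorm n θ p q f).toReal ^ (1 / (α + 1)) * δ ^ (α / (α + 1)))) ∧
    (∀ g : ℝ → ℝ × ℝ → ℝ,
      (∀ δ : ℝ, 0 < δ → MemLp (g δ) p FBP.sinoMeasure ∧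
        eLpNorm (fun z => FBP.radon f z - g δ z) p FBP.sinoMeasure ≤ ENNReal.ofReal δ) →
      (fun δ : ℝ => (eLpNorm (fun x => (f x : ℂ) - FBP.reconstruction W
          (FBP.bandwidth α (FBP.besovSeminorm n θ p q f).toReal δ) (g δ) x)
          p (volume.restrict Ω)).toReal)
        =O[𝓝[>] 0] (fun δ : ℝ => δ ^ (α / (α + 1)))) := by
  have hα0 : 0 < α := by rw [hα]; positivity
  refine ⟨fun δ hδ g hg hgδ L hL => ?_, fun g hg => ?_⟩
  · rw [hL]
    exact FBP.memLp_and_eLpNorm_sub_reconstruction_le hθ0 hα hp hq hΩ hf1 hfB.2.ne hf0 hWeven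
      hW0 hWc hA1 hAinv hK hmom hKα hδ hg.aestronglyMeasurable hgδ
  -- The constant of the explicit estimate does not depend on `δ`, so it serves as the bound for all
  -- `δ > 0`.
  · refine IsBigO.of_bound ((FBP.cApprox W n θ q + FBP.cData W Ω p) *
      (FBP.besovSeminorm n θ p q f).toReal ^ (1 / (α + 1))) ?_
    filter_upwards [self_mem_nhdsWithin] with δ hδ
    have hδ' : 0 < δ := hδ
    have h := (FBP.memLp_and_eLpNorm_sub_reconstruction_le hθ0 hα hp hq hΩ hf1 hfB.2.ne hf0 hWeven
      hW0 hWc hA1 hAinv hK hmom hKα hδ' (hg δ hδ').1.aestronglyMeasurable (hg δ hδ').2).2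
    have hc := add_nonneg (FBP.cApprox_nonneg W n hθ0 q) (FBP.cData_nonneg W Ω p)
    rw [Real.norm_of_nonneg ENNReal.toReal_nonneg, Real.norm_of_nonneg (by positivity)]
    exact ENNReal.toReal_le_of_le_ofReal (by positivity) h
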